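/- **Theorem (Consistency).** Let $\varphi:\mathbb R\to\mathbb R$ be continuous and $1$-periodic. For a continuous $h:X\to\mathbb R$ on a compact interval $X$, let $D(h)$ be the (undecorated) persistence diagram of the persistence module $$V_t=\begin{cases}H_0(\{x\in X: h(x)\le t\};\mathbb K), & t<\max h,\\ 0,& t\ge\max h,\end{cases}$$ where $\mathbb K$ is a field, $H_0$ is singular homology, and the structure maps are induced by inclusions (and are zero into $V_t$ for $t\ge \max h$). That is, the multiplicity of a point $(y_1,y_2)$, $y_1<y_2$, in $D(h)$ is the minimum, over all rectangles $[a,b]\times[c,d]$ with $a<y_1<b<c<y_2<d$, of $r(b,c)-r(a,c)-r(b,d)+r(a,d)$, where $r(s,t)=\operatorname{rank}(V_s\to V_t)$. Let $\varepsilon>0$, $p>1$ and $w_\varepsilon(y_1,y_2)=\max(y_2-y_1-\varepsilon,0)$. Let $\mathbb T$ be a set and let $k$ assign to each $x\in\mathbb R^2$ a function $k_x:\mathbb T\to\mathbb R$ such that, for some constants $L_k$ and $C$, $$\|k_x-k_{x'}\|_\infty\le L_k\|x-x'\|_\infty\quad(x,x'\in\mathbb R^2),\qquad \|k_{(r,r)}\|_\infty\le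 C\quad(r\in\mathbb R).$$ For a diagram $D$ put $$\overline\rho(D)(t)=\frac{\sum_{x\in D}w_\varepsilon(x)^p\,k_x(t)}{\sum_{x\in D}w_\varepsilon(x)^p}\qquad(t\in\mathbb T)$$ if the denominator is positive, and $\overline\rho(D)=0$ otherwise, points being counted with multiplicity. Then for every compact interval $[a,b]$ only finitely many points $x\in D(\varphi|_{[a,b]})$ have $w_\varepsilon(x)>0$; $\varphi$ has a global maximum point in $[0,1]$; and for every global maximum point $c\in\mathbb R$ of $\varphi$, $$\overline\rho\big(D(\varphi|_{[0,R]})\big)\longrightarrow\overline\rho\big(D(\varphi|_{[c,c+1]})\big)\quad\text{uniformly on }\mathbb T\text{ as }R\to\infty,$$ with, for all $R>1$, $$\big\|\overline\rho(D(\varphi|_{[0,R]}))-\overline\rho(D(\varphi|_{[c,c+1]}))\big\|_\infty\le\frac{4\,\big(C+L_k(\max\varphi-\min\varphi)\big)}{R-1}.$$ -/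

import Mathlib

open CategoryTheory

/-! ### Persistence modules over a field, indexed by `ℝ`, and their persistence diagrams -/

noncomputable section

universe u

/-- A persistence module over the field `𝕂`: vector spaces `V_t`, `t ∈ ℝ`, with
compatible structure maps `V_s → V_t` for `s ≤ t`. -/
abbrev PersistenceModule (𝕂 : Type u) [Field 𝕂] := ℝ ⥤ ModuleCat.{u} 𝕂

namespace PersistenceModule

variable {𝕂 : Type u} [Field 𝕂]

/-- The rank of the structure map `V_s → V_t`, for `s ≤ t`. -/
def rank (V : PersistenceModule 𝕂) (s t : ℝ) : ℕ :=
  if h : s ≤ t then Module.finrank 𝕂 (LinearMap.range (V.map (homOfLE h)).hom) else 0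

/-- The rectangle measure of `V` on the rectangle `[a, b] × [c, d]`, where `a < b < c < d`. -/
def rectMeasure (V : PersistenceModule 𝕂) (a b c d : ℝ) : ℤ :=
  (V.rank b c : ℤ) - V.rank a c - V.rank b d + V.rank a d

/-- The (undecorated) persistence diagram of `V`, as a multiset of points above the diagonal
given by its multiplicity function: the multiplicity of `(x.1, x.2)`, `x.1 < x.2`, is the minimum
of the rectangle measure over the rectangles that contain this point in their interior.
The points of the diagonal, conventionally of infinite multiplicity, carry
no truncated persistence and are left out: they get multiplicity `0`. -/
def diagram (V : PersistenceModule 𝕂) (x : ℝ × ℝ) : ℕ :=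
  sInf {n : ℕ | ∃ a b c d : ℝ, a < x.1 ∧ x.1 < b ∧ b < c ∧ c < x.2 ∧ x.2 < d ∧
    V.rectMeasure a b c d = n}

/-- The subspace of `V_t` that is divided out in order to kill `V_t` for `t ≥ M`:
it is `0` if `t < M` and all of `V_t` if `t ≥ M`. -/
def cut (V : PersistenceModule 𝕂) (M t : ℝ) : Submodule 𝕂 (V.obj t) :=
  open Classical in if t < M then ⊥ else ⊤

theorem cut_le_comap (V : PersistenceModule 𝕂) (M : ℝ) {s t : ℝ} (f : s ⟶ t) :
    V.cut M s ≤ (V.cut M t).comap (V.map f).hom := by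
  unfold cut
  by_cases hs : s < M
  · simp [hs]
  · have ht : ¬ t < M := fun ht => hs (lt_of_le_of_lt (leOfHom f) ht)
    simp [ht]

/-- The persistence module that is `V_t` for `t < M` and `0` for `t ≥ M`, with the structure maps
of `V` between indices `< M` and zero maps otherwise. -/
def truncate (V : PersistenceModule 𝕂) (M : ℝ) : PersistenceModule 𝕂 where
  obj t := ModuleCat.of 𝕂 (V.obj t ⧸ V.cut M t)
  map {s t} f := ModuleCat.ofHom
    (Submodule.mapQ (V.cut M s) (V.cut M t) (V.map f).hom (V.cut_le_comap M f))
  map_id t := by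
    ext x
    simp
  map_comp f g := by
    ext x
    simp

end PersistenceModule

/-! ### Sublevel sets -/

/-- The filtration of a space `X` by the sublevel sets `{x | h x ≤ t}` and their inclusions. -/
def sublevelFiltration {X : Type} [TopologicalSpace X] (h : X → ℝ) : ℝ ⥤ TopCat.{0} where
  obj t := TopCat.of {x : X | h x ≤ t}
  map {s t} f := TopCat.ofHom
    ⟨Set.inclusion (fun x (hx : h x ≤ s) => le_trans hx (leOfHom f)), continuous_inclusion _⟩

/-- The persistence module of sublevel sets of `h`:
`V_t = H₀({h ≤ t}; 𝕂)` (singular homology) if `t < max h`, and `V_t = 0` if `t ≥ max h`. -/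
def sublevelModule (𝕂 : Type u) [Field 𝕂] {X : Type} [TopologicalSpace X] (h : X → ℝ) :
    PersistenceModule 𝕂 :=
  PersistenceModule.truncate
    (sublevelFiltration h ⋙
      (AlgebraicTopology.singularHomologyFunctor (ModuleCat.{u} 𝕂) 0).obj (ModuleCat.of 𝕂 𝕂))
    (⨆ x, h x)

/-- The sublevel set persistence diagram of the restriction of `f` to `[a, b]`. -/
def intervalDiagram (𝕂 : Type u) [Field 𝕂] (f : ℝ → ℝ) (a b : ℝ) : ℝ × ℝ → ℕ :=
  (sublevelModule 𝕂 (fun x : Set.Icc a b => f x)).diagram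

/-! ### Functionals of persistence diagrams -/

/-- The `ε`-truncated persistence of a point `x = (birth, death)`. -/
def truncPers (ε : ℝ) (x : ℝ × ℝ) : ℝ := max (x.2 - x.1 - ε) 0

/-- The `p`-th power of the `ε`-truncated total `p`-persistence of a diagram. -/
def totalPersPow (ε p : ℝ) (D : ℝ × ℝ → ℕ) : ℝ :=
  ∑' x : ℝ × ℝ, (D x : ℝ) * truncPers ε x ^ p

/-- The linear functional of a diagram, with kernel `k` and weights `truncPers ε ^ p`. -/
def linearFunctional {T : Type*} (k : ℝ × ℝ → T → ℝ) (ε p : ℝ) (D : ℝ × ℝ → ℕ) (t : T) : ℝ :=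
  ∑' x : ℝ × ℝ, (D x : ℝ) * (truncPers ε x ^ p * k x t)

/-- The normalized functional of `ε`-truncated `p`-persistence of a diagram, with kernel `k`. -/
def normalizedFunctional {T : Type*} (k : ℝ × ℝ → T → ℝ) (ε p : ℝ) (D : ℝ × ℝ → ℕ) (t : T) : ℝ :=
  open Classical in
  if 0 < totalPersPow ε p D then linearFunctional k ε p D t / totalPersPow ε p D else 0

end

/-! On `H₀` the rank of `V_s → V_t` is the number of interval components of `{φ ≤ t}` that contain a
point of value at most `s`. For `t < max φ` no such component crosses a global maximum point, so
rank functions add exactly when an interval is cut there, and they are invariant under shifts by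
whole periods. Hence on `[0, R]` the rank function is `n • r + e`: `r` belongs to one period that
starts at a maximum, and `e` to the two end pieces. Each end piece lies inside a period, so `e ≤ 2 •
r` pointwise.

Diagrams are additive in the rank function (`IsRankFunction.rankDiagram_add`), so the functionals
split in the same way. The remainder is controlled by `IsRankFunction.totalPersPow_mono`: a
pointwise inequality of ranks passes to total persistence. This rests on `∫ r(s, s + τ) ds = ∑ D(x)
* max (x.2 - x.1 - τ) 0` and on writing `(max v 0) ^ p` as a positive mixture of the functions `max
(v - σ) 0`.

With the kernel bounded by `B = C + L (max φ - min φ)` on the diagram, a remainder of weight at most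
twice that of one period moves the weighted mean of `n` periods by at most `4 B / (n + 2)`, and `R <
n + 2`. -/

/-! ### Ranks on `H₀` as numbers of components -/

open Limits Simplicial in
/-- The class in `H₀` of a vertex of a simplicial set. -/
noncomputable def SSet.vertexClass {𝕂 : Type u} [Field 𝕂] (X : SSet.{0}) (x : X _⦋0⦌) :
    ModuleCat.of 𝕂 𝕂 ⟶ X.homology (ModuleCat.of 𝕂 𝕂) 0 :=
  (X.chainComplex (ModuleCat.of 𝕂 𝕂)).liftCycles (X.ιChainComplex x) 0 (by simp) (by simp) ≫
    (X.chainComplex (ModuleCat.of 𝕂 𝕂)).homologyπ 0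

open Limits Simplicial in
theorem SSet.vertexClass_comp_homologyMap {𝕂 : Type u} [Field 𝕂] {X Y : SSet.{0}} (f : X ⟶ Y)
    (x : X _⦋0⦌) :
    X.vertexClass (𝕂 := 𝕂) x ≫ SSet.homologyMap f (ModuleCat.of 𝕂 𝕂) 0 =
      Y.vertexClass (f.app _ x) := by
  unfold SSet.vertexClass
  unfold SSet.homologyMap
  rw [Category.assoc, HomologicalComplex.homologyπ_naturality,
    HomologicalComplex.liftCycles_comp_cyclesMap_assoc]
  congr 2
  exact SSet.ι_chainComplexMap_f (X := X) (f := f) (R := ModuleCat.of 𝕂 𝕂) (x := x) (Y := Y)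

open Limits Simplicial in
theorem SSet.vertexClass_comp_homology₀Iso {𝕂 : Type u} [Field 𝕂] (X : SSet.{0})
    (x : X _⦋0⦌) :
    X.vertexClass (𝕂 := 𝕂) x ≫ (X.homology₀Iso (ModuleCat.of 𝕂 𝕂)).hom =
      Sigma.ι (fun _ : π₀ X => ModuleCat.of 𝕂 𝕂) (π₀.mk x) := by
  unfold SSet.vertexClass
  rw [Category.assoc]
  exact SSet.liftCycles_ιChainComplex_homologyπ_homology₀Iso_hom _ _ _

theorem ModuleCat.linearIndependent_sigma_ι {𝕂 : Type u} [Field 𝕂] (ι : Type) :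
    LinearIndependent 𝕂 (fun i : ι =>
      (Limits.Sigma.ι (fun _ : ι => ModuleCat.of 𝕂 𝕂) i).hom (1 : 𝕂)) := by
  classical
  let c : ι → ((∐ fun _ : ι => ModuleCat.of 𝕂 𝕂 :) →ₗ[𝕂] 𝕂) := fun i =>
    (Limits.Sigma.desc (f := fun _ : ι => ModuleCat.of 𝕂 𝕂) (P := ModuleCat.of 𝕂 𝕂)
      (fun j => if j = i then 𝟙 _ else 0)).hom
  have hc : ∀ i j, c i ((Limits.Sigma.ι (fun _ : ι => ModuleCat.of 𝕂 𝕂) j).hom (1 : 𝕂)) =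
      if j = i then 1 else 0 := by
    intro i j
    have := congrArg (fun g => g.hom (1 : 𝕂))
      (Limits.Sigma.ι_desc (f := fun _ : ι => ModuleCat.of 𝕂 𝕂) (P := ModuleCat.of 𝕂 𝕂)
      (fun j => if j = i then 𝟙 _ else 0) j)
    refine Eq.trans this ?_
    split_ifs <;> simp
  rw [linearIndependent_iff']
  intro s g hg i hi
  have := congrArg (c i) hg
  rw [map_sum, map_zero] at this
  simpa [hc, hi] using this

theorem ModuleCat.span_sigma_ι {𝕂 : Type u} [Field 𝕂] (ι : Type) :
    Submodule.span 𝕂 (Set.range fun i : ι =>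
      (Limits.Sigma.ι (fun _ : ι => ModuleCat.of 𝕂 𝕂) i).hom (1 : 𝕂)) = ⊤ := by
  set S := Submodule.span 𝕂 (Set.range fun i : ι =>
      (Limits.Sigma.ι (fun _ : ι => ModuleCat.of 𝕂 𝕂) i).hom (1 : 𝕂)) with hS
  have h : ModuleCat.ofHom S.mkQ = 0 := by
    refine Limits.Sigma.hom_ext _ _ fun i => ?_
    ext
    simpa using Submodule.subset_span (Set.mem_range_self i)
  have h' : S.mkQ = 0 := congrArg ModuleCat.Hom.hom h
  rw [← S.ker_mkQ, h', LinearMap.ker_zero]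

/-- The class in `H₀` of a connected component of a simplicial set. -/
noncomputable def SSet.componentClass (𝕂 : Type u) [Field 𝕂] (X : SSet.{0}) (c : X.π₀) :
    (X.homology (ModuleCat.of 𝕂 𝕂) 0 : ModuleCat.{u} 𝕂) :=
  (X.homology₀Iso (ModuleCat.of 𝕂 𝕂)).inv.hom
    ((Limits.Sigma.ι (fun _ : X.π₀ => ModuleCat.of 𝕂 𝕂) c).hom (1 : 𝕂))

theorem SSet.linearIndependent_componentClass (𝕂 : Type u) [Field 𝕂] (X : SSet.{0}) :
    LinearIndependent 𝕂 (X.componentClass 𝕂) :=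
  (ModuleCat.linearIndependent_sigma_ι X.π₀).map'
    (X.homology₀Iso (ModuleCat.of 𝕂 𝕂)).toLinearEquiv.symm.toLinearMap
    (LinearEquiv.ker _)

theorem SSet.span_componentClass (𝕂 : Type u) [Field 𝕂] (X : SSet.{0}) :
    Submodule.span 𝕂 (Set.range (X.componentClass 𝕂)) = ⊤ := by
  have h := congrArg (Submodule.map
    (X.homology₀Iso (ModuleCat.of 𝕂 𝕂)).toLinearEquiv.symm.toLinearMap)
    (ModuleCat.span_sigma_ι (𝕂 := 𝕂) X.π₀)
  rw [Submodule.map_span, ← Set.range_comp, Submodule.map_top, LinearEquiv.range] at h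
  exact h

open Simplicial in
theorem SSet.componentClass_mk (𝕂 : Type u) [Field 𝕂] (X : SSet.{0}) (x : X _⦋0⦌) :
    X.componentClass 𝕂 (SSet.π₀.mk x) = (X.vertexClass (𝕂 := 𝕂) x).hom (1 : 𝕂) := by
  unfold SSet.componentClass
  rw [← SSet.vertexClass_comp_homology₀Iso]
  simp

open Simplicial in
-- The image is spanned by the classes of the components that are hit, and component classes are
-- linearly independent. No finiteness is needed: `finrank` and `ncard` both take the value `0` in
-- the infinite case.
theorem SSet.finrank_range_homologyMap_zero (𝕂 : Type u) [Field 𝕂] {X Y : SSet.{0}} (f : X ⟶ Y) :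
    Module.finrank 𝕂 (LinearMap.range (SSet.homologyMap f (ModuleCat.of 𝕂 𝕂) 0).hom) =
      (Set.range fun x : X _⦋0⦌ => SSet.π₀.mk (f.app _ x)).ncard := by
  have h1 : LinearMap.range (SSet.homologyMap f (ModuleCat.of 𝕂 𝕂) 0).hom =
      Submodule.span 𝕂 (Y.componentClass 𝕂 ''
        Set.range fun x : X _⦋0⦌ => SSet.π₀.mk (f.app _ x)) := by
    rw [← Submodule.map_top, ← SSet.span_componentClass, Submodule.map_span,
      ← (SSet.π₀.mk_surjective (X := X)).range_comp, ← Set.range_comp, ← Set.range_comp]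
    congr 2
    ext x
    simp only [Function.comp_apply, SSet.componentClass_mk, ← SSet.vertexClass_comp_homologyMap f x]
    rfl
  have hli := ((SSet.linearIndependent_componentClass 𝕂 Y).linearIndepOn
    (Set.range fun x : X _⦋0⦌ => SSet.π₀.mk (f.app _ x))).id_image
  rw [h1, Module.finrank, rank_span_set hli, ← Set.ncard_image_of_injective _
    (SSet.linearIndependent_componentClass 𝕂 Y).injective]
  rfl

theorem TopCat.finrank_range_singularHomologyFunctor_zero_map (𝕂 : Type u) [Field 𝕂]
    {X Y : TopCat.{0}} (f : X ⟶ Y) :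
    Module.finrank 𝕂 (LinearMap.range
      (((AlgebraicTopology.singularHomologyFunctor (ModuleCat.{u} 𝕂) 0).obj
        (ModuleCat.of 𝕂 𝕂)).map f).hom) =
      (Set.range fun x : X => ZerothHomotopy.mk (f.hom x)).ncard := by
  refine (SSet.finrank_range_homologyMap_zero 𝕂 (TopCat.toSSet.map f)).trans ?_
  rw [← Set.ncard_image_of_injective _ TopCat.zerothHomotopyEquiv.injective, ← Set.range_comp]
  congr 1
  refine (TopCat.toSSetObj₀Equiv (X := X)).symm.surjective.range_comp _ ▸ ?_
  rfl

theorem Submodule.range_mapQ_eq_map {K V W : Type*} [Field K] [AddCommGroup V] [Module K V]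
    [AddCommGroup W] [Module K W] (p : Submodule K V) (q : Submodule K W) (f : V →ₗ[K] W)
    (h : p ≤ q.comap f) :
    LinearMap.range (p.mapQ q f h) = (LinearMap.range f).map q.mkQ := by
  rw [← LinearMap.range_comp, ← Submodule.mapQ_mkQ p q f (h := h),
    LinearMap.range_comp_of_range_eq_top _ (Submodule.range_mkQ _)]

theorem Submodule.finrank_range_mapQ_bot {K V W : Type*} [Field K] [AddCommGroup V] [Module K V]
    [AddCommGroup W] [Module K W] (p : Submodule K V) {q : Submodule K W} (f : V →ₗ[K] W)
    (h : p ≤ q.comap f) (hq : q = ⊥) :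
    Module.finrank K (LinearMap.range (p.mapQ q f h)) = Module.finrank K (LinearMap.range f) := by
  have hinj : Function.Injective q.mkQ := by
    rw [← LinearMap.ker_eq_bot, Submodule.ker_mkQ, hq]
  rw [Submodule.range_mapQ_eq_map]
  exact (Submodule.equivMapOfInjective q.mkQ hinj (LinearMap.range f)).finrank_eq.symm

theorem Submodule.finrank_range_mapQ_top {K V W : Type*} [Field K] [AddCommGroup V] [Module K V]
    [AddCommGroup W] [Module K W] (p : Submodule K V) {q : Submodule K W} (f : V →ₗ[K] W)
    (h : p ≤ q.comap f) (hq : q = ⊤) :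
    Module.finrank K (LinearMap.range (p.mapQ q f h)) = 0 := by
  have hz : q.mkQ = 0 := by
    rw [← LinearMap.ker_eq_top, Submodule.ker_mkQ, hq]
  rw [Submodule.range_mapQ_eq_map, hz, Submodule.map_zero, finrank_bot]

/-- The rank of a structure map of a truncated persistence module. -/
theorem PersistenceModule.rank_truncate {𝕂 : Type u} [Field 𝕂] (V : PersistenceModule 𝕂)
    (M : ℝ) {s t : ℝ} (hst : s ≤ t) :
    (V.truncate M).rank s t = open Classical in if t < M then V.rank s t else 0 := by
  classical
  rw [PersistenceModule.rank, PersistenceModule.rank, dif_pos hst, dif_pos hst]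
  split_ifs with htM
  · exact Submodule.finrank_range_mapQ_bot (V.cut M s) (V.map (homOfLE hst)).hom
      (V.cut_le_comap M (homOfLE hst)) (by simp [PersistenceModule.cut, htM])
  · exact Submodule.finrank_range_mapQ_top (V.cut M s) (V.map (homOfLE hst)).hom
      (V.cut_le_comap M (homOfLE hst)) (by simp [PersistenceModule.cut, htM])

/-! ### Components of sublevel sets on the line -/

/-- The interval components of the sublevel set `{φ ≤ t}` that contain a point of `I` with
value `≤ s`. -/
def sublevelComponents (φ : ℝ → ℝ) (I : Set ℝ) (s t : ℝ) : Set (Set ℝ) :=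
  (fun x => Set.ordConnectedComponent {z | φ z ≤ t} x) '' {x | x ∈ I ∧ φ x ≤ s}

/-- The segment between two points of `I` stays in `I`, so components may be taken in `ℝ`. This
makes the components seen by different intervals comparable as sets. -/
theorem joined_sublevel_iff {φ : ℝ → ℝ} {I : Set ℝ} [I.OrdConnected] {t : ℝ}
    (x y : {x : I | φ x ≤ t}) :
    Joined x y ↔ Set.uIcc (x : ℝ) y ⊆ {z | φ z ≤ t} := by
  constructor
  · rintro ⟨γ⟩ z hz
    have hc : Continuous fun r => ((γ r : I) : ℝ) := by fun_prop
    have h := (isPreconnected_range hc).ordConnected.uIcc_subset (x := (x : ℝ)) (y := (y : ℝ))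
      ⟨0, by simp⟩ ⟨1, by simp⟩ hz
    obtain ⟨r, rfl⟩ := h
    exact (γ r).2
  · intro h
    have hI : Set.uIcc (x : ℝ) y ⊆ I := Set.OrdConnected.uIcc_subset ‹_› x.1.2 y.1.2
    have : PathConnectedSpace (Set.uIcc (x : ℝ) y) :=
      isPathConnected_iff_pathConnectedSpace.1
        ((convex_uIcc _ _).isPathConnected ⟨_, Set.left_mem_uIcc⟩)
    have hj := PathConnectedSpace.joined (⟨x, Set.left_mem_uIcc⟩ : Set.uIcc (x : ℝ) y)
      ⟨y, Set.right_mem_uIcc⟩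
    exact hj.map (f := fun w : Set.uIcc (x : ℝ) y => (⟨⟨w, hI w.2⟩, h w.2⟩ : {x : I | φ x ≤ t})) (by fun_prop)

theorem ordConnectedComponent_eq_iff {S : Set ℝ} {x y : ℝ} (hx : x ∈ S) :
    Set.ordConnectedComponent S x = Set.ordConnectedComponent S y ↔ Set.uIcc x y ⊆ S := by
  constructor
  · intro h
    rw [Set.uIcc_comm]
    have := Set.self_mem_ordConnectedComponent.2 hx
    rw [h] at this
    exact this
  · intro h
    exact Set.ordConnectedComponent_eq h

theorem rank_sublevelFiltration (𝕂 : Type u) [Field 𝕂] (φ : ℝ → ℝ) (I : Set ℝ) [I.OrdConnected]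
    {s t : ℝ} (hst : s ≤ t) :
    PersistenceModule.rank (sublevelFiltration (fun x : I => φ x) ⋙
      (AlgebraicTopology.singularHomologyFunctor (ModuleCat.{u} 𝕂) 0).obj (ModuleCat.of 𝕂 𝕂)) s t =
      (sublevelComponents φ I s t).ncard := by
  rw [PersistenceModule.rank, dif_pos hst]
  refine (TopCat.finrank_range_singularHomologyFunctor_zero_map 𝕂
    ((sublevelFiltration (fun x : I => φ x)).map (homOfLE hst))).trans ?_
  let c : {x : I | φ x ≤ t} → Set ℝ := fun x => Set.ordConnectedComponent {z | φ z ≤ t} x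
  have hc : ∀ x y, c x = c y ↔ Joined x y := fun x y => by
    rw [joined_sublevel_iff]
    exact ordConnectedComponent_eq_iff x.2
  let e : ZerothHomotopy {x : I | φ x ≤ t} → Set ℝ := Quotient.lift c fun x y h => (hc x y).2 h
  have he : Function.Injective e := by
    intro p q
    induction p using Quotient.inductionOn
    induction q using Quotient.inductionOn
    exact fun h => Quotient.sound ((hc _ _).1 h)
  refine (Set.ncard_image_of_injective _ he).symm.trans ?_
  congr 1
  ext C
  constructor
  · rintro ⟨_, ⟨x, rfl⟩, rfl⟩
    exact ⟨x.1.1, ⟨x.1.2, x.2⟩, rfl⟩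
  · rintro ⟨x, ⟨hxI, hxs⟩, rfl⟩
    exact ⟨_, ⟨⟨⟨x, hxI⟩, hxs⟩, rfl⟩, rfl⟩

theorem rank_sublevelModule (𝕂 : Type u) [Field 𝕂] (φ : ℝ → ℝ) (I : Set ℝ) [I.OrdConnected]
    {s t : ℝ} (hst : s ≤ t) :
    (sublevelModule 𝕂 (fun x : I => φ x)).rank s t =
      open Classical in if t < ⨆ x : I, φ x then (sublevelComponents φ I s t).ncard else 0 := by
  rw [sublevelModule, PersistenceModule.rank_truncate _ _ hst, rank_sublevelFiltration 𝕂 φ I hst]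

/-! ### Abstract rank functions and their diagrams -/

/-- The inclusion-exclusion count of a function `r s t` on the rectangle `[a, b] × [c, d]`. -/
def rectCount (r : ℝ → ℝ → ℤ) (a b c d : ℝ) : ℤ :=
  r b c - r a c - r b d + r a d

/-- The persistence diagram that belongs to a rank function. -/
noncomputable def rankDiagram (r : ℝ → ℝ → ℤ) (x : ℝ × ℝ) : ℕ :=
  sInf {n : ℕ | ∃ a b c d : ℝ, a < x.1 ∧ x.1 < b ∧ b < c ∧ c < x.2 ∧ x.2 < d ∧
    rectCount r a b c d = n}

/-- The rank functions of persistence modules that live between the levels `m` and `M`. -/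
structure IsRankFunction (r : ℝ → ℝ → ℤ) (m M : ℝ) : Prop where
  rectCount_nonneg : ∀ a b c d, a ≤ b → b < c → c ≤ d → 0 ≤ rectCount r a b c d
  eq_zero_of_lt : ∀ s t, s < t → s < m → r s t = 0
  eq_zero_of_le : ∀ s t, s < t → M ≤ t → r s t = 0

theorem rankDiagram_congr {r r' : ℝ → ℝ → ℤ} (h : ∀ s t, s < t → r s t = r' s t) :
    rankDiagram r = rankDiagram r' := by
  funext x
  unfold rankDiagram
  congr 1
  ext n
  refine exists_congr fun a => exists_congr fun b => exists_congr fun c => exists_congr fun d => ?_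
  refine and_congr_right fun h1 => and_congr_right fun h2 => and_congr_right fun h3 =>
    and_congr_right fun h4 => and_congr_right fun h5 => ?_
  rw [rectCount, rectCount, h b c h3, h a c (by linarith), h b d (by linarith),
    h a d (by linarith)]

theorem sum_rectCount_grid (r : ℝ → ℝ → ℤ) (f g : ℕ → ℝ) (m n : ℕ) :
    ∑ i ∈ Finset.range m, ∑ j ∈ Finset.range n,
      rectCount r (f i) (f (i + 1)) (g j) (g (j + 1)) = rectCount r (f 0) (f m) (g 0) (g n) := by
  have h1 : ∀ i, ∑ j ∈ Finset.range n, rectCount r (f i) (f (i + 1)) (g j) (g (j + 1)) =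
      (r (f (i + 1)) (g 0) - r (f (i + 1)) (g n)) - (r (f i) (g 0) - r (f i) (g n)) := by
    intro i
    rw [← Finset.sum_range_sub' (fun j => r (f (i + 1)) (g j)),
      ← Finset.sum_range_sub' (fun j => r (f i) (g j)), ← Finset.sum_sub_distrib]
    refine Finset.sum_congr rfl fun j _ => ?_
    unfold rectCount
    ring
  simp only [h1]
  rw [Finset.sum_range_sub (fun i => r (f i) (g 0) - r (f i) (g n))]
  unfold rectCount
  ring

/-- The windows `[p - δ, p + δ]` do not overlap; the induction peels off the rightmost one. -/
theorem sum_sub_le_of_monotoneOn {g : ℝ → ℤ} {a b δ : ℝ} (hab : a ≤ b) (hδ : 0 < δ)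
    (hg : MonotoneOn g (Set.Icc a b)) (P : Finset ℝ)
    (hP : ∀ p ∈ P, a ≤ p - δ ∧ p + δ ≤ b) (hsep : ∀ p ∈ P, ∀ q ∈ P, p < q → p + δ ≤ q - δ) :
    ∑ p ∈ P, (g (p + δ) - g (p - δ)) ≤ g b - g a := by
  induction P using Finset.induction_on_max generalizing b with
  | empty => simpa using hg ⟨le_rfl, hab⟩ ⟨hab, le_rfl⟩ hab
  | insert q P hq ih =>
    rw [Finset.sum_insert fun h => (hq q h).false]
    obtain ⟨q1, q2⟩ := hP q (Finset.mem_insert_self _ _)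
    have h1 := ih (b := q - δ) q1 (hg.mono (Set.Icc_subset_Icc_right (by linarith)))
      (fun p hp => ⟨(hP p (Finset.mem_insert_of_mem hp)).1,
        hsep p (Finset.mem_insert_of_mem hp) q (Finset.mem_insert_self _ _) (hq p hp)⟩)
      (fun p hp p' hp' => hsep p (Finset.mem_insert_of_mem hp) p' (Finset.mem_insert_of_mem hp'))
    have h2 := hg (a := q + δ) ⟨by linarith, q2⟩ ⟨hab, le_rfl⟩ q2
    linarith

open Filter Topology in
theorem eventually_add_le_sub (P : Finset ℝ) :
    ∀ᶠ δ in 𝓝[>] (0 : ℝ), ∀ p ∈ P, ∀ q ∈ P, p < q → p + δ ≤ q - δ := by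
  refine (Finset.eventually_all P).2 fun p _ => (Finset.eventually_all P).2 fun q _ => ?_
  by_cases hpq : p < q
  · filter_upwards [Ioo_mem_nhdsGT (show 0 < (q - p) / 2 by linarith)] with δ hδ _
    linarith [hδ.2]
  · exact .of_forall fun _ h => absurd h hpq

namespace IsRankFunction

variable {r r₁ r₂ : ℝ → ℝ → ℤ} {m M : ℝ}

/-- The difference of the two rectangles is cut into four rectangles of nonnegative count. -/
theorem rectCount_mono (h : IsRankFunction r m M) {a b c d a' b' c' d' : ℝ} (h1 : a' ≤ a)
    (h2 : a ≤ b) (h3 : b ≤ b') (h4 : b' < c') (h5 : c' ≤ c) (h6 : c ≤ d) (h7 : d ≤ d') :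
    rectCount r a b c d ≤ rectCount r a' b' c' d' := by
  have e1 := h.rectCount_nonneg a' a c d h1 (by linarith) h6
  have e2 := h.rectCount_nonneg b b' c d h3 (by linarith) h6
  have e3 := h.rectCount_nonneg a' b' c' c (by linarith) h4 h5
  have e4 := h.rectCount_nonneg a' b' d d' (by linarith) (by linarith) h7
  unfold rectCount at *
  linarith

theorem add (h₁ : IsRankFunction r₁ m M) (h₂ : IsRankFunction r₂ m M) :
    IsRankFunction (r₁ + r₂) m M where
  rectCount_nonneg a b c d hab hbc hcd := by
    have e1 := h₁.rectCount_nonneg a b c d hab hbc hcd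
    have e2 := h₂.rectCount_nonneg a b c d hab hbc hcd
    simp only [rectCount, Pi.add_apply] at *
    linarith
  eq_zero_of_lt s t hst hs := by
    simp [h₁.eq_zero_of_lt s t hst hs, h₂.eq_zero_of_lt s t hst hs]
  eq_zero_of_le s t hst ht := by
    simp [h₁.eq_zero_of_le s t hst ht, h₂.eq_zero_of_le s t hst ht]

theorem zero : IsRankFunction 0 m M where
  rectCount_nonneg a b c d _ _ _ := by simp [rectCount]
  eq_zero_of_lt := by simp
  eq_zero_of_le := by simp

theorem nsmul (h : IsRankFunction r m M) (n : ℕ) : IsRankFunction (n • r) m M := by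
  induction n with
  | zero => simpa using zero
  | succ k ih => rw [succ_nsmul]; exact ih.add h

theorem rankDiagram_le (h : IsRankFunction r m M) {x : ℝ × ℝ} {a b c d : ℝ} (ha : a < x.1)
    (hb : x.1 < b) (hbc : b < c) (hc : c < x.2) (hd : x.2 < d) :
    (rankDiagram r x : ℤ) ≤ rectCount r a b c d := by
  have h0 := h.rectCount_nonneg a b c d (by linarith) hbc (by linarith)
  have : rankDiagram r x ≤ (rectCount r a b c d).toNat :=
    Nat.sInf_le ⟨a, b, c, d, ha, hb, hbc, hc, hd, (Int.toNat_of_nonneg h0).symm⟩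
  omega

theorem exists_rectCount_eq (h : IsRankFunction r m M) {x : ℝ × ℝ} (hx : x.1 < x.2) :
    ∃ a b c d : ℝ, a < x.1 ∧ x.1 < b ∧ b < c ∧ c < x.2 ∧ x.2 < d ∧
      rectCount r a b c d = rankDiagram r x := by
  refine Nat.sInf_mem (s := {n : ℕ | ∃ a b c d : ℝ, a < x.1 ∧ x.1 < b ∧ b < c ∧ c < x.2 ∧ x.2 < d ∧
    rectCount r a b c d = n}) ?_
  have h0 := h.rectCount_nonneg (x.1 - 1) (x.1 + (x.2 - x.1) / 3) (x.1 + (x.2 - x.1) / 3 * 2)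
    (x.2 + 1) (by linarith) (by linarith) (by linarith)
  exact ⟨_, _, _, _, _, by linarith, by linarith, by linarith, by linarith, by linarith,
    (Int.toNat_of_nonneg h0).symm⟩

theorem rankDiagram_of_le (r : ℝ → ℝ → ℤ) {x : ℝ × ℝ} (hx : x.2 ≤ x.1) : rankDiagram r x = 0 := by
  have : {n : ℕ | ∃ a b c d : ℝ, a < x.1 ∧ x.1 < b ∧ b < c ∧ c < x.2 ∧ x.2 < d ∧
    rectCount r a b c d = n} = ∅ := by
    rw [Set.eq_empty_iff_forall_notMem]
    rintro n ⟨a, b, c, d, h1, h2, h3, h4, h5, -⟩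
    linarith
  rw [rankDiagram, this, Nat.sInf_empty]

/-- The minima are attained, being infima in `ℕ`. By monotonicity the intersection of an optimal
rectangle for `r₁` with one for `r₂` is optimal for both at once. -/
theorem rankDiagram_add (h₁ : IsRankFunction r₁ m M) (h₂ : IsRankFunction r₂ m M) :
    rankDiagram (r₁ + r₂) = rankDiagram r₁ + rankDiagram r₂ := by
  funext x
  rw [Pi.add_apply]
  rcases le_or_gt x.2 x.1 with hx | hx
  · simp [rankDiagram_of_le, hx]
  have hadd : ∀ a b c d, rectCount (r₁ + r₂) a b c d = rectCount r₁ a b c d + rectCount r₂ a b c d :=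
    fun a b c d => by simp only [rectCount, Pi.add_apply]; ring
  obtain ⟨a₁, b₁, c₁, d₁, ha₁, hb₁, hbc₁, hc₁, hd₁, e₁⟩ := h₁.exists_rectCount_eq hx
  obtain ⟨a₂, b₂, c₂, d₂, ha₂, hb₂, hbc₂, hc₂, hd₂, e₂⟩ := h₂.exists_rectCount_eq hx
  obtain ⟨a, b, c, d, ha, hb, hbc, hc, hd, e⟩ := (h₁.add h₂).exists_rectCount_eq hx
  have u := (h₁.add h₂).rankDiagram_le (x := x) (a := max a₁ a₂) (b := min b₁ b₂) (c := max c₁ c₂)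
    (d := min d₁ d₂) (max_lt ha₁ ha₂) (lt_min hb₁ hb₂)
    ((min_le_left _ _).trans_lt (hbc₁.trans_le (le_max_left _ _))) (max_lt hc₁ hc₂)
    (lt_min hd₁ hd₂)
  have v₁ := h₁.rankDiagram_le ha hb hbc hc hd
  have v₂ := h₂.rankDiagram_le ha hb hbc hc hd
  have hx1 : max a₁ a₂ ≤ min b₁ b₂ := ((max_lt ha₁ ha₂).trans (lt_min hb₁ hb₂)).le
  have hx2 : max c₁ c₂ ≤ min d₁ d₂ := ((max_lt hc₁ hc₂).trans (lt_min hd₁ hd₂)).le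
  have w₁ := h₁.rectCount_mono (le_max_left a₁ a₂) hx1 (min_le_left b₁ b₂) hbc₁
    (le_max_left c₁ c₂) hx2 (min_le_left d₁ d₂)
  have w₂ := h₂.rectCount_mono (le_max_right a₁ a₂) hx1 (min_le_right b₁ b₂) hbc₂
    (le_max_right c₁ c₂) hx2 (min_le_right d₁ d₂)
  rw [hadd] at e u
  omega

theorem rankDiagram_nsmul (h : IsRankFunction r m M) (n : ℕ) :
    rankDiagram (n • r) = n • rankDiagram r := by
  induction n with
  | zero =>
    funext x
    rcases le_or_gt x.2 x.1 with hx | hx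
    · simp [rankDiagram_of_le, hx]
    · have := (zero (m := m) (M := M)).rankDiagram_le (x := x) (a := x.1 - 1)
        (b := x.1 + (x.2 - x.1) / 3) (c := x.1 + (x.2 - x.1) / 3 * 2) (d := x.2 + 1)
        (by linarith) (by linarith) (by linarith) (by linarith) (by linarith)
      simp [rectCount] at this
      simpa using this
  | succ k ih => rw [succ_nsmul, (h.nsmul k).rankDiagram_add h, ih, succ_nsmul]

/-- The rank `r s t` is at least the number of points of the diagram in the open quadrant
`{x | x.1 < s ∧ t < x.2}`. -/
theorem sum_rankDiagram_le (h : IsRankFunction r m M) {s t : ℝ} (hst : s < t)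
    (A : Finset (ℝ × ℝ)) (hA : ∀ x ∈ A, x.1 < s ∧ t < x.2) :
    ∑ x ∈ A, (rankDiagram r x : ℤ) ≤ r s t := by
  classical
  set P := A.image Prod.fst with hP
  set Q := A.image Prod.snd with hQ
  have hPs : ∀ p ∈ P, p < s := by
    intro p hp
    obtain ⟨x, hx, rfl⟩ := Finset.mem_image.1 hp
    exact (hA x hx).1
  have hQt : ∀ q ∈ Q, t < q := by
    intro q hq
    obtain ⟨x, hx, rfl⟩ := Finset.mem_image.1 hq
    exact (hA x hx).2
  -- For small `δ` the squares of radius `δ` centred on the grid `P × Q` do not overlap and stay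
  -- inside the quadrant.
  obtain ⟨δ, ⟨⟨⟨hsepP, hsepQ⟩, hδP⟩, hδQ⟩, hδ⟩ :=
    (((((eventually_add_le_sub P).and (eventually_add_le_sub Q)).and
      ((Finset.eventually_all P).2 fun p hp =>
        Filter.eventually_iff_exists_mem.2 ⟨_, Ioo_mem_nhdsGT (sub_pos.2 (hPs p hp)),
          fun y hy => hy.2⟩)).and
      ((Finset.eventually_all Q).2 fun q hq =>
        Filter.eventually_iff_exists_mem.2 ⟨_, Ioo_mem_nhdsGT (sub_pos.2 (hQt q hq)),
          fun y hy => hy.2⟩)).and (eventually_mem_nhdsWithin)).exists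
  rw [Set.mem_Ioi] at hδ
  -- With `a < m` and `M ≤ d` the rank vanishes on the outer sides, so the count of `[a, s] × [t,
  -- d]` is `r s t`.
  obtain ⟨a, ha⟩ : ∃ a, ∀ p ∈ insert s (insert m P), a < p - δ := by
    obtain ⟨a, ha⟩ := ((insert s (insert m P)).image (· - δ)).bddBelow
    exact ⟨a - 1, fun p hp => (sub_one_lt a).trans_le (ha (Finset.mem_image_of_mem _ hp))⟩
  obtain ⟨d, hd⟩ : ∃ d, ∀ q ∈ insert t (insert M Q), q + δ < d := by
    obtain ⟨d, hd⟩ := ((insert t (insert M Q)).image (· + δ)).bddAbove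
    exact ⟨d + 1, fun p hp => (hd (Finset.mem_image_of_mem _ hp)).trans_lt (lt_add_one d)⟩
  have has : a < s := by linarith [ha s (by simp)]
  have ham : a < m := by linarith [ha m (by simp)]
  have hdt : t < d := by linarith [hd t (by simp)]
  have hdM : M ≤ d := by linarith [hd M (by simp)]
  have hrow : ∀ q ∈ Q, ∑ p ∈ P, rectCount r (p - δ) (p + δ) (q - δ) (q + δ) ≤
      r s (q - δ) - r s (q + δ) := by
    intro q hq
    have hqδ := hδQ q hq
    have := sum_sub_le_of_monotoneOn (g := fun u => r u (q - δ) - r u (q + δ)) has.le hδ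
      (fun u hu v hv huv => by
        have := h.rectCount_nonneg u v (q - δ) (q + δ) huv (by linarith [hv.2]) (by linarith)
        simp only [rectCount] at this ⊢
        linarith) P
      (fun p hp => ⟨(ha p (by simp [hp])).le, by linarith [hδP p hp]⟩) hsepP
    simp only [h.eq_zero_of_lt a (q - δ) (by linarith) ham,
      h.eq_zero_of_lt a (q + δ) (by linarith) ham] at this
    refine le_trans (le_of_eq (Finset.sum_congr rfl fun p _ => ?_)) (this.trans (by simp))
    unfold rectCount
    ring
  have hcol : ∑ q ∈ Q, (r s (q - δ) - r s (q + δ)) ≤ r s t := by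
    have := sum_sub_le_of_monotoneOn (g := fun v => - r s v) hdt.le hδ
      (fun u hu v hv huv => by
        have h1 := h.rectCount_nonneg a s u v has.le (by linarith [hu.1]) huv
        rw [rectCount, h.eq_zero_of_lt a u (by linarith [hu.1]) ham,
          h.eq_zero_of_lt a v (by linarith [hv.1]) ham] at h1
        simp only
        linarith) Q
      (fun q hq => ⟨by linarith [hδQ q hq], (hd q (by simp [hq])).le⟩) hsepQ
    rw [h.eq_zero_of_le s d (hst.trans hdt) hdM] at this
    refine le_trans (le_of_eq (Finset.sum_congr rfl fun q _ => ?_)) (this.trans (by simp))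
    ring
  have hnn : ∀ p ∈ P, ∀ q ∈ Q, 0 ≤ rectCount r (p - δ) (p + δ) (q - δ) (q + δ) :=
    fun p hp q hq => h.rectCount_nonneg _ _ _ _ (by linarith)
      (by linarith [hδP p hp, hδQ q hq]) (by linarith)
  calc _ ≤ ∑ x ∈ A, rectCount r (x.1 - δ) (x.1 + δ) (x.2 - δ) (x.2 + δ) := by
        refine Finset.sum_le_sum fun x hx => ?_
        have h1 := hδP x.1 (Finset.mem_image_of_mem _ hx)
        have h2 := hδQ x.2 (Finset.mem_image_of_mem _ hx)
        exact h.rankDiagram_le (by linarith) (by linarith) (by linarith) (by linarith)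
          (by linarith)
    _ ≤ ∑ x ∈ P ×ˢ Q, rectCount r (x.1 - δ) (x.1 + δ) (x.2 - δ) (x.2 + δ) := by
        refine Finset.sum_le_sum_of_subset_of_nonneg (fun x hx => ?_) fun x hx _ => ?_
        · exact Finset.mem_product.2 ⟨Finset.mem_image_of_mem _ hx, Finset.mem_image_of_mem _ hx⟩
        · rw [Finset.mem_product] at hx
          exact hnn _ hx.1 _ hx.2
    _ = ∑ q ∈ Q, ∑ p ∈ P, rectCount r (p - δ) (p + δ) (q - δ) (q + δ) :=
        Finset.sum_product_right _ _ _
    _ ≤ _ := Finset.sum_le_sum hrow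
    _ ≤ _ := hcol

theorem le_of_rankDiagram_ne_zero (h : IsRankFunction r m M) {x : ℝ × ℝ}
    (hx : rankDiagram r x ≠ 0) : x.1 < x.2 ∧ m ≤ x.1 ∧ x.2 ≤ M := by
  have h12 : x.1 < x.2 := by
    by_contra h'
    exact hx (rankDiagram_of_le r (not_lt.1 h'))
  refine ⟨h12, ?_, ?_⟩
  · by_contra! hm
    obtain ⟨b, hb1, hb2⟩ := exists_between (lt_min hm h12)
    rw [lt_min_iff] at hb2
    obtain ⟨c, hc1, hc2⟩ := exists_between hb2.2
    have := h.rankDiagram_le (a := x.1 - 1) (d := x.2 + 1) (by linarith) hb1 hc1 hc2 (by linarith)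
    rw [rectCount, h.eq_zero_of_lt b c hc1 hb2.1, h.eq_zero_of_lt _ c (by linarith) (by linarith),
      h.eq_zero_of_lt b _ (by linarith) hb2.1, h.eq_zero_of_lt _ _ (by linarith) (by linarith)]
      at this
    omega
  · by_contra! hm
    obtain ⟨c, hc1, hc2⟩ := exists_between (max_lt hm h12)
    rw [max_lt_iff] at hc1
    obtain ⟨b, hb1, hb2⟩ := exists_between hc1.2
    have := h.rankDiagram_le (a := x.1 - 1) (d := x.2 + 1) (by linarith) hb1 hb2 hc2 (by linarith)
    rw [rectCount, h.eq_zero_of_le b c hb2 hc1.1.le, h.eq_zero_of_le _ c (by linarith) hc1.1.le,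
      h.eq_zero_of_le b _ (by linarith) (by linarith),
      h.eq_zero_of_le _ _ (by linarith) (by linarith)] at this
    omega

theorem finite_quadrant (h : IsRankFunction r m M) {s t : ℝ} (hst : s < t) :
    {x : ℝ × ℝ | rankDiagram r x ≠ 0 ∧ x.1 < s ∧ t < x.2}.Finite := by
  by_contra hinf
  obtain ⟨A, hA, hcard⟩ := Set.Infinite.exists_subset_card_eq hinf ((r s t).toNat + 1)
  have h1 := h.sum_rankDiagram_le hst A fun x hx => (hA hx).2
  have h2 : ∑ x ∈ A, (1 : ℤ) ≤ ∑ x ∈ A, (rankDiagram r x : ℤ) :=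
    Finset.sum_le_sum fun x hx => by have := (hA hx).1; omega
  simp at h2
  omega

/-- A diagram has finitely many points of persistence above a given positive level. -/
theorem finite_persistence (h : IsRankFunction r m M) {ε : ℝ} (hε : 0 < ε) :
    {x : ℝ × ℝ | rankDiagram r x ≠ 0 ∧ ε < x.2 - x.1}.Finite := by
  -- Births lie in `[m, M]`; a point born in the `k`-th cell of width `ε / 2` that lives longer than
  -- `ε` dies more than `ε / 2` after the end of the cell.
  have hfin : (⋃ k ∈ Set.Icc ⌊m / (ε / 2)⌋ ⌊M / (ε / 2)⌋,
      {x : ℝ × ℝ | rankDiagram r x ≠ 0 ∧ x.1 < ((k : ℝ) + 1) * (ε / 2) ∧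
        ((k : ℝ) + 1) * (ε / 2) + ε / 2 < x.2}).Finite :=
    (Set.finite_Icc _ _).biUnion fun k _ => h.finite_quadrant (by linarith)
  refine hfin.subset fun x hx => ?_
  obtain ⟨h1, h2, h3⟩ := h.le_of_rankDiagram_ne_zero hx.1
  have hε2 : 0 < ε / 2 := by linarith
  refine Set.mem_biUnion (x := ⌊x.1 / (ε / 2)⌋)
    ⟨Int.floor_mono (by gcongr), Int.floor_mono (by gcongr; linarith)⟩ ⟨hx.1, ?_, ?_⟩
  · rw [← div_lt_iff₀ hε2]
    exact Int.lt_floor_add_one _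
  · have := (le_div_iff₀ hε2).1 (Int.floor_le (x.1 / (ε / 2)))
    linarith [hx.2]

/-- The rank `r s t` is at most the number of points of the diagram in the closed quadrant
`{x | x.1 ≤ s ∧ t ≤ x.2}`. -/
theorem exists_le_sum_rankDiagram (h : IsRankFunction r m M) {s t : ℝ} (hst : s < t) :
    ∃ A : Finset (ℝ × ℝ), (∀ x ∈ A, x.1 ≤ s ∧ t ≤ x.2) ∧
      r s t ≤ ∑ x ∈ A, (rankDiagram r x : ℤ) := by
  classical
  obtain ⟨a, ha⟩ := exists_lt (min m s)
  obtain ⟨d, hd⟩ := exists_gt (max M t)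
  rw [lt_min_iff] at ha
  rw [max_lt_iff] at hd
  -- As `s < t`, this compact rectangle lies above the diagonal, so optimal rectangles around its
  -- points cover it; `A` will be the set of centres of a finite subcover.
  set K : Set (ℝ × ℝ) := Set.Icc a s ×ˢ Set.Icc t d with hK
  have hKc : IsCompact K := isCompact_Icc.prod isCompact_Icc
  have hex : ∀ x : ℝ × ℝ, ∃ q : (ℝ × ℝ) × (ℝ × ℝ), x ∈ K →
      (q.1.1 < x.1 ∧ x.1 < q.1.2 ∧ q.1.2 < q.2.1 ∧ q.2.1 < x.2 ∧ x.2 < q.2.2 ∧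
      rectCount r q.1.1 q.1.2 q.2.1 q.2.2 = rankDiagram r x) := by
    intro x
    by_cases hx : x ∈ K
    · obtain ⟨a, b, c, d, h⟩ := h.exists_rectCount_eq
        (show x.1 < x.2 by linarith [hx.1.2, hx.2.1])
      exact ⟨((a, b), (c, d)), fun _ => h⟩
    · exact ⟨0, fun h => absurd h hx⟩
  choose q hq using hex
  let U : ℝ × ℝ → Set (ℝ × ℝ) := fun x =>
    Set.Ioo (q x).1.1 (q x).1.2 ×ˢ Set.Ioo (q x).2.1 (q x).2.2
  have hUo : ∀ x, IsOpen (U x) := fun x => isOpen_Ioo.prod isOpen_Ioo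
  obtain ⟨A, hAK, hAU⟩ := hKc.elim_nhds_subcover U fun x hx => (hUo x).mem_nhds
    ⟨⟨(hq x hx).1, (hq x hx).2.1⟩, ⟨(hq x hx).2.2.2.1, (hq x hx).2.2.2.2.1⟩⟩
  refine ⟨A, fun x hx => ⟨(hAK x hx).1.2, (hAK x hx).2.1⟩, ?_⟩
  -- A grid finer than the Lebesgue number has each cell inside one optimal rectangle; the cells are
  -- then grouped by the chosen centre.
  obtain ⟨δ, hδ, hleb⟩ := lebesgue_number_lemma_of_metric (c := fun i : A => U i) hKc
    (fun i => hUo i) (by simpa [Set.iUnion_subtype] using hAU)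
  obtain ⟨n, hn⟩ := exists_nat_gt (max (s - a) (d - t) / δ)
  have hn0 : (0 : ℝ) < n := lt_of_le_of_lt
    (div_nonneg (le_max_of_le_left (by linarith)) hδ.le) hn
  rw [div_lt_iff₀ hδ, max_lt_iff] at hn
  set f : ℕ → ℝ := fun i => a + i * ((s - a) / n) with hf
  set g : ℕ → ℝ := fun j => t + j * ((d - t) / n) with hg
  have hfn : f n = s := by simp only [hf]; field_simp; ring
  have hgn : g n = d := by simp only [hg]; field_simp; ring
  have hf1 : ∀ i, f (i + 1) = f i + (s - a) / n := fun i => by simp only [hf]; push_cast; ring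
  have hg1 : ∀ i, g (i + 1) = g i + (d - t) / n := fun i => by simp only [hg]; push_cast; ring
  have hfm : Monotone f := monotone_nat_of_le_succ fun i => by
    rw [hf1]; linarith [div_pos (show 0 < s - a by linarith) hn0]
  have hgm : Monotone g := monotone_nat_of_le_succ fun i => by
    rw [hg1]; linarith [div_pos (show 0 < d - t by linarith) hn0]
  have hfδ : (s - a) / n < δ := by rw [div_lt_iff₀ hn0]; linarith
  have hgδ : (d - t) / n < δ := by rw [div_lt_iff₀ hn0]; linarith
  have hcell : ∀ p : ℕ × ℕ, ∃ x : ℝ × ℝ, p ∈ Finset.range n ×ˢ Finset.range n → x ∈ A ∧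
      (q x).1.1 ≤ f p.1 ∧ f (p.1 + 1) ≤ (q x).1.2 ∧ (q x).2.1 ≤ g p.2 ∧
      g (p.2 + 1) ≤ (q x).2.2 := by
    intro p
    by_cases hp : p ∈ Finset.range n ×ˢ Finset.range n
    swap
    · exact ⟨0, fun h => absurd h hp⟩
    rw [Finset.mem_product, Finset.mem_range, Finset.mem_range] at hp
    have hz : (f p.1, g p.2) ∈ K :=
      ⟨⟨by simpa [hf] using hfm (Nat.zero_le p.1), by rw [← hfn]; exact hfm hp.1.le⟩,
        ⟨by simpa [hg] using hgm (Nat.zero_le p.2), by rw [← hgn]; exact hgm hp.2.le⟩⟩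
    obtain ⟨i, hi⟩ := hleb _ hz
    have z1 := hi (Metric.mem_ball_self hδ)
    have z2 : (f (p.1 + 1), g (p.2 + 1)) ∈ U i := by
      refine hi ?_
      rw [Metric.mem_ball, Prod.dist_eq, max_lt_iff, Real.dist_eq, Real.dist_eq]
      simp only [hf1, hg1, add_sub_cancel_left]
      rw [abs_of_pos (div_pos (by linarith) hn0), abs_of_pos (div_pos (by linarith) hn0)]
      exact ⟨hfδ, hgδ⟩
    exact ⟨i, fun _ => ⟨i.2, z1.1.1.le, z2.1.2.le, z1.2.1.le, z2.2.2.le⟩⟩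
  choose k hk using hcell
  have hr : r s t = rectCount r (f 0) (f n) (g 0) (g n) := by
    have h0 : f 0 = a := by simp [hf]
    have h0' : g 0 = t := by simp [hg]
    rw [hfn, hgn, h0, h0', rectCount, h.eq_zero_of_lt a t (by linarith) ha.1,
      h.eq_zero_of_le s d (by linarith) hd.1.le, h.eq_zero_of_le a d (by linarith) hd.1.le]
    ring
  rw [hr, ← sum_rectCount_grid, ← Finset.sum_product',
    ← Finset.sum_fiberwise_of_maps_to (g := k) (t := A) (fun p hp => (hk p hp).1)]
  refine Finset.sum_le_sum fun x hx => ?_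
  obtain ⟨q1, q2, q3, q4, q5, q6⟩ := hq x (hAK x hx)
  -- Clamping the grid to the rectangle of `x` fixes the cells assigned to `x` and keeps all other
  -- counts nonnegative. The full clamped sum telescopes to a rectangle inside that of `x`.
  have hc1 : Monotone fun i => max (q x).1.1 (min (f i) (q x).1.2) :=
    fun i j hij => max_le_max le_rfl (min_le_min (hfm hij) le_rfl)
  have hc2 : Monotone fun i => max (q x).2.1 (min (g i) (q x).2.2) :=
    fun i j hij => max_le_max le_rfl (min_le_min (hgm hij) le_rfl)
  have b1 : ∀ i, max (q x).1.1 (min (f i) (q x).1.2) ≤ (q x).1.2 :=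
    fun i => max_le (by linarith) (min_le_right _ _)
  have b2 : ∀ i, max (q x).2.1 (min (g i) (q x).2.2) ≤ (q x).2.2 :=
    fun i => max_le (by linarith) (min_le_right _ _)
  rw [← q6]
  calc _ ≤ ∑ p ∈ (Finset.range n ×ˢ Finset.range n) with k p = x,
        rectCount r (max (q x).1.1 (min (f p.1) (q x).1.2))
          (max (q x).1.1 (min (f (p.1 + 1)) (q x).1.2))
          (max (q x).2.1 (min (g p.2) (q x).2.2))
          (max (q x).2.1 (min (g (p.2 + 1)) (q x).2.2)) := by
        refine Finset.sum_le_sum fun p hp => le_of_eq ?_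
        rw [Finset.mem_filter] at hp
        obtain ⟨-, k1, k2, k3, k4⟩ := hk p hp.1
        rw [hp.2] at k1 k2 k3 k4
        have l1 := hfm (Nat.le_succ p.1)
        have l2 := hgm (Nat.le_succ p.2)
        simp only [Nat.succ_eq_add_one] at l1 l2
        rw [min_eq_left k2, min_eq_left k4, min_eq_left (l1.trans k2), min_eq_left (l2.trans k4),
          max_eq_right k1, max_eq_right k3, max_eq_right (k1.trans l1), max_eq_right (k3.trans l2)]
    _ ≤ ∑ p ∈ Finset.range n ×ˢ Finset.range n,
        rectCount r (max (q x).1.1 (min (f p.1) (q x).1.2))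
          (max (q x).1.1 (min (f (p.1 + 1)) (q x).1.2))
          (max (q x).2.1 (min (g p.2) (q x).2.2))
          (max (q x).2.1 (min (g (p.2 + 1)) (q x).2.2)) := by
        refine Finset.sum_le_sum_of_subset_of_nonneg (Finset.filter_subset _ _) fun p _ _ => ?_
        exact h.rectCount_nonneg _ _ _ _ (hc1 (Nat.le_succ _))
          ((b1 _).trans_lt (q3.trans_le (le_max_left _ _))) (hc2 (Nat.le_succ _))
    _ = _ := Finset.sum_product _ _ _
    _ = _ := sum_rectCount_grid r (fun i => max (q x).1.1 (min (f i) (q x).1.2))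
      (fun i => max (q x).2.1 (min (g i) (q x).2.2)) n n
    _ ≤ _ := h.rectCount_mono (le_max_left _ _) (hc1 (Nat.zero_le _)) (b1 _) q3
      (le_max_left _ _) (hc2 (Nat.zero_le _)) (b2 _)

end IsRankFunction

/-! ### Monotonicity of truncated total persistence -/

open MeasureTheory

theorem integral_sum_indicator (A : Finset (ℝ × ℝ)) (w : ℝ × ℝ → ℝ) (S : ℝ × ℝ → Set ℝ)
    (hS : ∀ x, MeasurableSet (S x)) (hS' : ∀ x, volume (S x) ≠ ⊤) :
    Integrable (fun s => ∑ x ∈ A, (S x).indicator (fun _ => w x) s) ∧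
    ∫ s, ∑ x ∈ A, (S x).indicator (fun _ => w x) s = ∑ x ∈ A, w x * volume.real (S x) := by
  have hi : ∀ x, Integrable ((S x).indicator fun _ => w x) := fun x =>
    (integrable_indicator_iff (hS x)).2 (integrableOn_const (hS' x))
  refine ⟨integrable_finsetSum _ fun x _ => hi x, ?_⟩
  rw [integral_finsetSum _ fun x _ => hi x]
  refine Finset.sum_congr rfl fun x _ => ?_
  rw [integral_indicator_const _ (hS x), smul_eq_mul, mul_comm]

/-- For each `s`, the open quadrant count of `r₁` at `(s, s + τ)` is at most `r₁`, hence at most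
`r₂`, hence at most the closed quadrant count of `r₂`. Integrated over `s`, a point contributes the
length of an interval, which is the same whether open or closed. -/
theorem IsRankFunction.sum_mul_max_le {r₁ r₂ : ℝ → ℝ → ℤ} {m₁ M₁ m₂ M₂ : ℝ}
    (h₁ : IsRankFunction r₁ m₁ M₁) (h₂ : IsRankFunction r₂ m₂ M₂)
    (hr : ∀ s t, s < t → r₁ s t ≤ r₂ s t) {τ : ℝ} (hτ : 0 < τ) (A₁ A₂ : Finset (ℝ × ℝ))
    (hA₂ : ∀ x, rankDiagram r₂ x ≠ 0 → τ ≤ x.2 - x.1 → x ∈ A₂) :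
    ∑ x ∈ A₁, (rankDiagram r₁ x : ℝ) * max (x.2 - x.1 - τ) 0 ≤
      ∑ x ∈ A₂, (rankDiagram r₂ x : ℝ) * max (x.2 - x.1 - τ) 0 := by
  classical
  obtain ⟨i1, e1⟩ := integral_sum_indicator A₁ (fun x => rankDiagram r₁ x)
    (fun x => Set.Ioo x.1 (x.2 - τ)) (fun _ => measurableSet_Ioo) (fun _ => by simp)
  obtain ⟨i2, e2⟩ := integral_sum_indicator A₂ (fun x => rankDiagram r₂ x)
    (fun x => Set.Icc x.1 (x.2 - τ)) (fun _ => measurableSet_Icc) (fun _ => by simp)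
  have hv : ∀ x : ℝ × ℝ, x.2 - τ - x.1 = x.2 - x.1 - τ := fun x => by ring
  simp only [measureReal_def, Real.volume_Ioo, Real.volume_Icc, ENNReal.toReal_ofReal', hv]
    at e1 e2
  rw [← e1, ← e2]
  refine integral_mono i1 i2 fun s => ?_
  have hs : s < s + τ := by linarith
  have l1 := h₁.sum_rankDiagram_le hs (A₁.filter fun x => s ∈ Set.Ioo x.1 (x.2 - τ)) fun x hx => by
    obtain ⟨-, a, b⟩ := Finset.mem_filter.1 hx
    exact ⟨a, by linarith⟩
  obtain ⟨B, hB, l2⟩ := h₂.exists_le_sum_rankDiagram hs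
  have l3 : ∑ x ∈ B, (rankDiagram r₂ x : ℤ) ≤
      ∑ x ∈ A₂.filter (fun x => s ∈ Set.Icc x.1 (x.2 - τ)), (rankDiagram r₂ x : ℤ) := by
    rw [← Finset.sum_filter_ne_zero]
    refine Finset.sum_le_sum_of_subset_of_nonneg (fun x hx => ?_) fun _ _ _ => by positivity
    rw [Finset.mem_filter] at hx ⊢
    obtain ⟨a, b⟩ := hB x hx.1
    exact ⟨hA₂ x (by exact_mod_cast hx.2) (by linarith), a, by linarith⟩
  have l4 := l1.trans ((hr s _ hs).trans (l2.trans l3))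
  rw [Finset.sum_filter, Finset.sum_filter] at l4
  simp only [Set.indicator_apply]
  exact_mod_cast l4

/-- Here `p > 1` matters: the exponent `p - 2` exceeds `-1`. -/
theorem intervalIntegrable_rpow_mul_max {p : ℝ} (hp : 1 < p) (v V : ℝ) :
    IntervalIntegrable (fun σ : ℝ => σ ^ (p - 2) * max (v - σ) 0) volume 0 V :=
  (intervalIntegral.intervalIntegrable_rpow' (by linarith)).mul_continuousOn (by fun_prop)

/-- The function `v ↦ (max v 0) ^ p` as a mixture of the functions `v ↦ max (v - σ) 0`. -/
theorem max_rpow_eq_integral {p : ℝ} (hp : 1 < p) {v V : ℝ} (hV : 0 ≤ V) (hvV : v ≤ V) :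
    max v 0 ^ p = p * (p - 1) * ∫ σ in (0 : ℝ)..V, σ ^ (p - 2) * max (v - σ) 0 := by
  rcases le_or_gt v 0 with hv | hv
  · rw [max_eq_right hv, Real.zero_rpow (by linarith), intervalIntegral.integral_congr
      (g := fun _ => (0 : ℝ)) (fun σ hσ => ?_)]
    · simp
    · rw [Set.uIcc_of_le hV] at hσ
      simp [max_eq_right (show v - σ ≤ 0 by linarith [hσ.1])]
  · have i1 := intervalIntegrable_rpow_mul_max hp v v
    have i2 := intervalIntegrable_rpow_mul_max hp v V
    rw [← intervalIntegral.integral_add_adjacent_intervals i1 (i1.symm.trans i2),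
      intervalIntegral.integral_congr (a := v) (b := V) (g := fun _ => (0 : ℝ)) (fun σ hσ => ?_),
      intervalIntegral.integral_congr (a := 0) (b := v)
        (g := fun σ => v * σ ^ (p - 2) - σ ^ (p - 1)) (fun σ hσ => ?_),
      intervalIntegral.integral_sub
        ((intervalIntegral.intervalIntegrable_rpow' (by linarith)).const_mul v)
        (intervalIntegral.intervalIntegrable_rpow' (by linarith)),
      intervalIntegral.integral_const_mul, integral_rpow (Or.inl (by linarith)),
      integral_rpow (Or.inl (by linarith)), max_eq_left hv.le]
    · have e : v ^ p = v * v ^ (p - 1) := by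
        rw [Real.rpow_sub_one hv.ne']
        field_simp
      rw [show p - 2 + 1 = p - 1 by ring, show p - 1 + 1 = p by ring,
        Real.zero_rpow (by linarith), Real.zero_rpow (by linarith), e]
      have : p - 1 ≠ 0 := by linarith
      have : p ≠ 0 := by linarith
      simp only [sub_zero, intervalIntegral.integral_zero, add_zero]
      field_simp
      ring
    · rw [Set.uIcc_of_le hv.le] at hσ
      rcases hσ.1.eq_or_lt with h0 | h0
      · simp only [← h0, sub_zero, max_eq_left hv.le]
        rw [Real.zero_rpow (x := p - 1) (by linarith)]
        ring
      · simp only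
        rw [max_eq_left (by linarith [hσ.2]), show p - 1 = p - 2 + 1 by ring,
          Real.rpow_add_one h0.ne']
        ring
    · rw [Set.uIcc_of_le hvV] at hσ
      simp [max_eq_right (show v - σ ≤ 0 by linarith [hσ.1])]

theorem totalPersPow_eq_sum {ε p : ℝ} (hp : 0 < p) {D : ℝ × ℝ → ℕ} {A : Finset (ℝ × ℝ)}
    (hA : ∀ x, D x ≠ 0 → 0 < truncPers ε x → x ∈ A) :
    totalPersPow ε p D = ∑ x ∈ A, (D x : ℝ) * truncPers ε x ^ p := by
  refine tsum_eq_sum fun x hx => ?_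
  by_cases hD : D x = 0
  · simp [hD]
  · have : truncPers ε x = 0 := le_antisymm (not_lt.1 fun h => hx (hA x hD h)) (le_max_right _ _)
    rw [this, Real.zero_rpow hp.ne', mul_zero]

theorem linearFunctional_eq_sum {T : Type*} (k : ℝ × ℝ → T → ℝ) {ε p : ℝ} (hp : 0 < p)
    {D : ℝ × ℝ → ℕ} {A : Finset (ℝ × ℝ)} (hA : ∀ x, D x ≠ 0 → 0 < truncPers ε x → x ∈ A) (t : T) :
    linearFunctional k ε p D t = ∑ x ∈ A, (D x : ℝ) * (truncPers ε x ^ p * k x t) := by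
  refine tsum_eq_sum fun x hx => ?_
  by_cases hD : D x = 0
  · simp [hD]
  · have : truncPers ε x = 0 := le_antisymm (not_lt.1 fun h => hx (hA x hD h)) (le_max_right _ _)
    rw [this, Real.zero_rpow hp.ne', zero_mul, mul_zero]

theorem IsRankFunction.finite_truncPers {r : ℝ → ℝ → ℤ} {m M : ℝ} (h : IsRankFunction r m M)
    {ε : ℝ} (hε : 0 < ε) : {x : ℝ × ℝ | rankDiagram r x ≠ 0 ∧ 0 < truncPers ε x}.Finite := by
  refine (h.finite_persistence hε).subset fun x hx => ⟨hx.1, ?_⟩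
  have := hx.2
  simp only [truncPers, lt_max_iff, lt_irrefl, or_false] at this
  linarith

/-- The truncated total persistence is monotone in the rank function. -/
theorem IsRankFunction.totalPersPow_mono {r₁ r₂ : ℝ → ℝ → ℤ} {m₁ M₁ m₂ M₂ : ℝ}
    (h₁ : IsRankFunction r₁ m₁ M₁) (h₂ : IsRankFunction r₂ m₂ M₂)
    (hr : ∀ s t, s < t → r₁ s t ≤ r₂ s t) {ε p : ℝ} (hε : 0 < ε) (hp : 1 < p) :
    totalPersPow ε p (rankDiagram r₁) ≤ totalPersPow ε p (rankDiagram r₂) := by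
  classical
  set A₁ := (h₁.finite_truncPers hε).toFinset with hA₁
  set A₂ := (h₂.finite_truncPers hε).toFinset with hA₂
  rw [totalPersPow_eq_sum (by linarith) (A := A₁) (fun x h h' => by simp [hA₁, h, h']),
    totalPersPow_eq_sum (by linarith) (A := A₂) (fun x h h' => by simp [hA₂, h, h'])]
  -- A common upper limit of integration for all points of both diagrams.
  obtain ⟨V, hV⟩ := (insert 0 ((A₁ ∪ A₂).image fun x => x.2 - x.1 - ε)).bddAbove
  have hV0 : 0 ≤ V := hV (by simp)
  have key : ∀ (A : Finset (ℝ × ℝ)) (D : ℝ × ℝ → ℕ), A ⊆ A₁ ∪ A₂ →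
      IntervalIntegrable (fun σ : ℝ => σ ^ (p - 2) *
        ∑ x ∈ A, (D x : ℝ) * max (x.2 - x.1 - (ε + σ)) 0) volume 0 V ∧
      ∑ x ∈ A, (D x : ℝ) * truncPers ε x ^ p = p * (p - 1) * ∫ σ in (0 : ℝ)..V, σ ^ (p - 2) *
        ∑ x ∈ A, (D x : ℝ) * max (x.2 - x.1 - (ε + σ)) 0 := by
    intro A D hA
    have e : (fun σ : ℝ => σ ^ (p - 2) * ∑ x ∈ A, (D x : ℝ) * max (x.2 - x.1 - (ε + σ)) 0) =
        fun σ => ∑ x ∈ A, (D x : ℝ) * (σ ^ (p - 2) * max (x.2 - x.1 - ε - σ) 0) := by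
      funext σ
      rw [Finset.mul_sum]
      refine Finset.sum_congr rfl fun x _ => ?_
      rw [← sub_sub]
      ring
    have hi : ∀ x ∈ A, IntervalIntegrable (fun σ : ℝ => (D x : ℝ) * (σ ^ (p - 2) *
        max (x.2 - x.1 - ε - σ) 0)) volume 0 V := fun x _ =>
      (intervalIntegrable_rpow_mul_max hp _ _).const_mul _
    rw [e]
    refine ⟨by simpa only [Finset.sum_fn] using IntervalIntegrable.sum A hi, ?_⟩
    rw [intervalIntegral.integral_finsetSum hi, Finset.mul_sum]
    refine Finset.sum_congr rfl fun x hx => ?_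
    rw [intervalIntegral.integral_const_mul, truncPers, max_rpow_eq_integral hp hV0
      (hV (Finset.mem_coe.2 (Finset.mem_insert_of_mem
        (Finset.mem_image_of_mem (fun x : ℝ × ℝ => x.2 - x.1 - ε) (hA hx)))))]
    ring
  obtain ⟨i1, e1⟩ := key A₁ (rankDiagram r₁) Finset.subset_union_left
  obtain ⟨i2, e2⟩ := key A₂ (rankDiagram r₂) Finset.subset_union_right
  rw [e1, e2]
  refine mul_le_mul_of_nonneg_left ?_ (mul_nonneg (by linarith) (by linarith))
  refine intervalIntegral.integral_mono_on_of_le_Ioo hV0 i1 i2 fun σ hσ => ?_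
  refine mul_le_mul_of_nonneg_left ?_ (Real.rpow_nonneg hσ.1.le _)
  refine h₁.sum_mul_max_le h₂ hr (by linarith [hσ.1]) A₁ A₂ fun x hx hx' => ?_
  simp only [hA₂, Set.Finite.mem_toFinset, Set.mem_ofPred_eq, truncPers, lt_max_iff]
  exact ⟨hx, Or.inl (by linarith [hσ.1])⟩

/-! ### Rank functions of sublevel sets: finiteness, additivity, periodicity -/

theorem sublevelComponents_mono {φ : ℝ → ℝ} {I J : Set ℝ} (hIJ : I ⊆ J) {s s' : ℝ} (hs : s ≤ s')
    (t : ℝ) : sublevelComponents φ I s t ⊆ sublevelComponents φ J s' t :=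
  Set.image_mono fun _ hx => ⟨hIJ hx.1, hx.2.trans hs⟩

/-- By uniform continuity `φ` cannot climb from `s` above `t` within distance `δ`, so each cell of
length `δ` meets at most one of these components in a point of value at most `s`. -/
theorem finite_sublevelComponents {φ : ℝ → ℝ} (hφ : Continuous φ) (a b : ℝ) {s t : ℝ}
    (hst : s < t) : (sublevelComponents φ (Set.Icc a b) s t).Finite := by
  have hu := isCompact_Icc.uniformContinuousOn_of_continuous (hφ.continuousOn (s := Set.Icc a b))
  obtain ⟨δ, hδ, h⟩ := Metric.uniformContinuousOn_iff.1 hu (t - s) (by linarith)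
  have hcomp : ∀ x y, x ∈ Set.Icc a b → y ∈ Set.Icc a b → φ x ≤ s → ⌊x / δ⌋ = ⌊y / δ⌋ →
      Set.ordConnectedComponent {z | φ z ≤ t} x = Set.ordConnectedComponent {z | φ z ≤ t} y := by
    intro x y hx hy hxs hxy
    rw [ordConnectedComponent_eq_iff (S := {z | φ z ≤ t}) (show φ x ≤ t by linarith)]
    intro z hz
    have hxy' : |y - x| < δ := by
      have := Int.abs_sub_lt_one_of_floor_eq_floor hxy.symm
      rwa [← sub_div, abs_div, abs_of_pos hδ, div_lt_one hδ] at this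
    have hzx : |z - x| < δ := (Set.abs_sub_left_of_mem_uIcc hz).trans_lt hxy'
    have := h z (Set.uIcc_subset_Icc hx hy hz) x hx (by rwa [Real.dist_eq])
    rw [Real.dist_eq, abs_lt] at this
    show φ z ≤ t
    linarith [this.2]
  have hex : ∀ C : Set ℝ, ∃ x, C ∈ sublevelComponents φ (Set.Icc a b) s t →
      (x ∈ Set.Icc a b ∧ φ x ≤ s) ∧ Set.ordConnectedComponent {z | φ z ≤ t} x = C := by
    intro C
    by_cases hC : C ∈ sublevelComponents φ (Set.Icc a b) s t
    · obtain ⟨x, hx, e⟩ := hC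
      exact ⟨x, fun _ => ⟨hx, e⟩⟩
    · exact ⟨0, fun h => absurd h hC⟩
  choose g hg using hex
  refine Set.Finite.of_injOn (f := fun C => ⌊g C / δ⌋) (t := Set.Icc ⌊a / δ⌋ ⌊b / δ⌋)
    (fun C hC => ?_) (fun C hC C' hC' hCC' => ?_) (Set.finite_Icc _ _)
  · obtain ⟨⟨⟨h1, h2⟩, -⟩, -⟩ := hg C hC
    exact ⟨Int.floor_mono (by gcongr), Int.floor_mono (by gcongr)⟩
  · obtain ⟨⟨h1, h2⟩, h3⟩ := hg C hC
    obtain ⟨⟨h1', h2'⟩, h3'⟩ := hg C' hC'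
    rw [← h3, ← h3']
    exact hcomp _ _ h1 h1' h2 hCC'

/-- This is nonnegativity of the rectangle count. The map `g` sends a component at level `c` to the
one at level `d` around it; a component at level `d` with no point of value at most `a` can only
come from such a component at level `c`. -/
theorem ncard_sublevelComponents_diff_le {φ : ℝ → ℝ} {I : Set ℝ} {a b c d : ℝ} (hbc : b ≤ c)
    (hcd : c ≤ d) (hfin : (sublevelComponents φ I b c).Finite) :
    (sublevelComponents φ I b d \ sublevelComponents φ I a d).ncard ≤
      (sublevelComponents φ I b c \ sublevelComponents φ I a c).ncard := by
  let g : Set ℝ → Set ℝ := fun C => ⋃ y ∈ C, Set.ordConnectedComponent {z | φ z ≤ d} y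
  have hg : ∀ x, φ x ≤ c → g (Set.ordConnectedComponent {z | φ z ≤ c} x) =
      Set.ordConnectedComponent {z | φ z ≤ d} x := by
    intro x hx
    have hsub : ∀ y ∈ Set.ordConnectedComponent {z | φ z ≤ c} x,
        Set.ordConnectedComponent {z | φ z ≤ d} y = Set.ordConnectedComponent {z | φ z ≤ d} x :=
      fun y hy => (Set.ordConnectedComponent_eq (hy.trans fun z (hz : φ z ≤ c) => hz.trans hcd)).symm
    ext z
    simp only [g, Set.mem_iUnion]
    constructor
    · rintro ⟨y, hy, hz⟩
      rwa [hsub y hy] at hz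
    · exact fun hz => ⟨x, Set.self_mem_ordConnectedComponent.2 hx, hz⟩
  have hsub : sublevelComponents φ I b d \ sublevelComponents φ I a d ⊆
      g '' (sublevelComponents φ I b c \ sublevelComponents φ I a c) := by
    rintro _ ⟨⟨x, ⟨hxI, hxb⟩, rfl⟩, hna⟩
    refine ⟨_, ⟨⟨x, ⟨hxI, hxb⟩, rfl⟩, ?_⟩, hg x (hxb.trans hbc)⟩
    rintro ⟨x', ⟨hx'I, hx'a⟩, e⟩
    by_cases hab : a ≤ b
    · refine hna ⟨x', ⟨hx'I, hx'a⟩, ?_⟩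
      simp only at e ⊢
      rw [← hg x' (hx'a.trans (hab.trans hbc)), e, hg x (hxb.trans hbc)]
    · exact hna ⟨x, ⟨hxI, hxb.trans (not_le.1 hab).le⟩, rfl⟩
  exact (Set.ncard_le_ncard hsub (hfin.sdiff.image g)).trans (Set.ncard_image_le hfin.sdiff)

/-- The rank function of the sublevel sets of `φ` on `I`, cut off at the level `M`. -/
noncomputable def sublevelRank (φ : ℝ → ℝ) (I : Set ℝ) (M s t : ℝ) : ℤ :=
  open Classical in if t < M then ((sublevelComponents φ I s t).ncard : ℤ) else 0

theorem isRankFunction_sublevelRank {φ : ℝ → ℝ} (hφ : Continuous φ) (a b m M : ℝ)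
    (hm : ∀ x ∈ Set.Icc a b, m ≤ φ x) :
    IsRankFunction (sublevelRank φ (Set.Icc a b) M) m M where
  rectCount_nonneg α β γ δ hαβ hβγ hγδ := by
    have hsub : ∀ t, sublevelComponents φ (Set.Icc a b) α t ⊆
      sublevelComponents φ (Set.Icc a b) β t := fun t => sublevelComponents_mono le_rfl hαβ t
    have f1 := finite_sublevelComponents hφ a b hβγ
    have f2 := finite_sublevelComponents hφ a b (hβγ.trans_le hγδ)
    have d1 := Set.ncard_sdiff_add_ncard_of_subset (hsub γ) f1
    have d2 := Set.ncard_sdiff_add_ncard_of_subset (hsub δ) f2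
    have d3 := ncard_sublevelComponents_diff_le (a := α) hβγ.le hγδ f1
    unfold rectCount sublevelRank
    split_ifs <;> first | omega | (exfalso; linarith)
  eq_zero_of_lt s t hst hs := by
    have : sublevelComponents φ (Set.Icc a b) s t = ∅ := by
      rw [sublevelComponents, Set.image_eq_empty, Set.eq_empty_iff_forall_notMem]
      rintro x ⟨hx, hxs⟩
      linarith [hm x hx]
    simp [sublevelRank, this]
  eq_zero_of_le s t hst ht := by
    simp [sublevelRank, not_lt.2 ht]

theorem sublevelRank_mono {φ : ℝ → ℝ} (hφ : Continuous φ) {a b a' b' : ℝ} (ha : a' ≤ a)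
    (hb : b ≤ b') (M : ℝ) {s t : ℝ} (hst : s < t) :
    sublevelRank φ (Set.Icc a b) M s t ≤ sublevelRank φ (Set.Icc a' b') M s t := by
  unfold sublevelRank
  split_ifs
  · exact_mod_cast Set.ncard_le_ncard
      (sublevelComponents_mono (Set.Icc_subset_Icc ha hb) le_rfl t)
      (finite_sublevelComponents hφ _ _ hst)
  · exact le_rfl

/-- Below the level `φ c` no component contains `c`, so none is counted on both sides; from `φ c`
on, the cut-off makes every term zero. -/
theorem sublevelRank_Icc_add {φ : ℝ → ℝ} (hφ : Continuous φ) {a b c : ℝ} (hac : a ≤ c)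
    (hcb : c ≤ b) {s t : ℝ} (hst : s < t) :
    sublevelRank φ (Set.Icc a b) (φ c) s t =
      sublevelRank φ (Set.Icc a c) (φ c) s t + sublevelRank φ (Set.Icc c b) (φ c) s t := by
  unfold sublevelRank
  split_ifs with ht
  · have hU : sublevelComponents φ (Set.Icc a b) s t =
        sublevelComponents φ (Set.Icc a c) s t ∪ sublevelComponents φ (Set.Icc c b) s t := by
      rw [sublevelComponents, sublevelComponents, sublevelComponents, ← Set.image_union]
      congr 1
      ext x
      rw [← Set.Icc_union_Icc_eq_Icc hac hcb]
      exact or_and_right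
    have hD : Disjoint (sublevelComponents φ (Set.Icc a c) s t)
        (sublevelComponents φ (Set.Icc c b) s t) := by
      rw [Set.disjoint_left]
      rintro _ ⟨x, ⟨hx, hxs⟩, rfl⟩ ⟨y, ⟨hy, hys⟩, e⟩
      have h := (ordConnectedComponent_eq_iff (S := {z | φ z ≤ t}) (show φ x ≤ t by linarith)).1 e.symm
      have : φ c ≤ t := h (Set.mem_uIcc_of_le hx.2 hy.1)
      linarith
    rw [hU, Set.ncard_union_eq hD (finite_sublevelComponents hφ _ _ hst)
      (finite_sublevelComponents hφ _ _ hst)]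
    push_cast
    rfl
  · rfl

theorem sublevelRank_Icc_add_period {φ : ℝ → ℝ} {T : ℝ} (hT : Function.Periodic φ T)
    (a b M : ℝ) : sublevelRank φ (Set.Icc (a + T) (b + T)) M = sublevelRank φ (Set.Icc a b) M := by
  funext s t
  have hcomp : ∀ x, (fun z => z + T) ⁻¹' Set.ordConnectedComponent {z | φ z ≤ t} (x + T) =
      Set.ordConnectedComponent {z | φ z ≤ t} x := by
    intro x
    ext z
    rw [Set.mem_preimage, Set.mem_ordConnectedComponent, Set.mem_ordConnectedComponent,
      ← Set.image_add_const_uIcc, Set.image_subset_iff]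
    simp only [Set.preimage_ofPred_eq, hT _]
  have hcard : (sublevelComponents φ (Set.Icc (a + T) (b + T)) s t).ncard =
      (sublevelComponents φ (Set.Icc a b) s t).ncard := by
    have hinj : Function.Injective (Set.preimage fun z : ℝ => z + T) :=
      Set.preimage_injective.2 (add_right_surjective T)
    rw [← Set.ncard_image_of_injective _ hinj]
    congr 1
    ext C
    constructor
    · rintro ⟨_, ⟨x, ⟨hx, hxs⟩, rfl⟩, rfl⟩
      refine ⟨x - T, ⟨⟨by linarith [hx.1], by linarith [hx.2]⟩, ?_⟩, ?_⟩
      · rwa [← hT (x - T), sub_add_cancel]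
      · simp only
        rw [← hcomp, sub_add_cancel]
    · rintro ⟨x, ⟨hx, hxs⟩, rfl⟩
      exact ⟨_, ⟨x + T, ⟨⟨by linarith [hx.1], by linarith [hx.2]⟩, by rwa [hT]⟩, rfl⟩, hcomp x⟩
  simp only [sublevelRank, hcard]

theorem intervalDiagram_eq_rankDiagram (𝕂 : Type*) [Field 𝕂] (φ : ℝ → ℝ) (a b : ℝ) :
    intervalDiagram 𝕂 φ a b =
      rankDiagram (sublevelRank φ (Set.Icc a b) (⨆ x : Set.Icc a b, φ x)) := by
  refine Eq.trans (b := rankDiagram fun s t =>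
    ((sublevelModule 𝕂 fun x : Set.Icc a b => φ x).rank s t : ℤ)) rfl
    (rankDiagram_congr fun s t hst => ?_)
  rw [rank_sublevelModule 𝕂 φ _ hst.le, sublevelRank]
  split_ifs <;> rfl

theorem intervalDiagram_eq_of_max (𝕂 : Type*) [Field 𝕂] {φ : ℝ → ℝ} {a b c : ℝ}
    (hc : c ∈ Set.Icc a b) (hmax : ∀ x, φ x ≤ φ c) :
    intervalDiagram 𝕂 φ a b = rankDiagram (sublevelRank φ (Set.Icc a b) (φ c)) := by
  have : Nonempty (Set.Icc a b) := ⟨⟨c, hc⟩⟩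
  have : ⨆ x : Set.Icc a b, φ x = φ c :=
    le_antisymm (ciSup_le fun x => hmax x)
      (le_ciSup (f := fun x : Set.Icc a b => φ x) ⟨φ c, by rintro _ ⟨x, rfl⟩; exact hmax x⟩ ⟨c, hc⟩)
  rw [intervalDiagram_eq_rankDiagram, this]

/-! ### Estimates for the functionals -/

theorem totalPersPow_nonneg (ε p : ℝ) (D : ℝ × ℝ → ℕ) : 0 ≤ totalPersPow ε p D :=
  tsum_nonneg fun _ => mul_nonneg (Nat.cast_nonneg _) (Real.rpow_nonneg (le_max_right _ _) _)

theorem finite_truncPers_add {D E : ℝ × ℝ → ℕ} {ε : ℝ}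
    (hD : {x | D x ≠ 0 ∧ 0 < truncPers ε x}.Finite)
    (hE : {x | E x ≠ 0 ∧ 0 < truncPers ε x}.Finite) (n : ℕ) :
    ∃ A : Finset (ℝ × ℝ), (∀ x, D x ≠ 0 → 0 < truncPers ε x → x ∈ A) ∧
      (∀ x, E x ≠ 0 → 0 < truncPers ε x → x ∈ A) ∧
      (∀ x, (n • D + E) x ≠ 0 → 0 < truncPers ε x → x ∈ A) := by
  classical
  have h1 : ∀ x, D x ≠ 0 → 0 < truncPers ε x → x ∈ hD.toFinset ∪ hE.toFinset :=
    fun x h h' => by simp [h, h']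
  have h2 : ∀ x, E x ≠ 0 → 0 < truncPers ε x → x ∈ hD.toFinset ∪ hE.toFinset :=
    fun x h h' => by simp [h, h']
  refine ⟨hD.toFinset ∪ hE.toFinset, h1, h2, fun x h h' => ?_⟩
  by_cases hx : D x = 0
  · exact h2 x (by simpa [hx] using h) h'
  · exact h1 x hx h'

theorem totalPersPow_nsmul_add {ε p : ℝ} (hp : 0 < p) {D E : ℝ × ℝ → ℕ}
    (hD : {x | D x ≠ 0 ∧ 0 < truncPers ε x}.Finite)
    (hE : {x | E x ≠ 0 ∧ 0 < truncPers ε x}.Finite) (n : ℕ) :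
    totalPersPow ε p (n • D + E) = n * totalPersPow ε p D + totalPersPow ε p E := by
  obtain ⟨A, h1, h2, h3⟩ := finite_truncPers_add hD hE n
  rw [totalPersPow_eq_sum hp h1, totalPersPow_eq_sum hp h2, totalPersPow_eq_sum hp h3,
    Finset.mul_sum, ← Finset.sum_add_distrib]
  refine Finset.sum_congr rfl fun x _ => ?_
  simp only [Pi.add_apply, Pi.smul_apply, smul_eq_mul]
  push_cast
  ring

theorem linearFunctional_nsmul_add {T : Type*} (k : ℝ × ℝ → T → ℝ) {ε p : ℝ} (hp : 0 < p)
    {D E : ℝ × ℝ → ℕ} (hD : {x | D x ≠ 0 ∧ 0 < truncPers ε x}.Finite)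
    (hE : {x | E x ≠ 0 ∧ 0 < truncPers ε x}.Finite) (n : ℕ) (t : T) :
    linearFunctional k ε p (n • D + E) t =
      n * linearFunctional k ε p D t + linearFunctional k ε p E t := by
  obtain ⟨A, h1, h2, h3⟩ := finite_truncPers_add hD hE n
  rw [linearFunctional_eq_sum k hp h1, linearFunctional_eq_sum k hp h2,
    linearFunctional_eq_sum k hp h3, Finset.mul_sum, ← Finset.sum_add_distrib]
  refine Finset.sum_congr rfl fun x _ => ?_
  simp only [Pi.add_apply, Pi.smul_apply, smul_eq_mul]
  push_cast
  ring

theorem abs_linearFunctional_le {T : Type*} {k : ℝ × ℝ → T → ℝ} {ε p : ℝ} (hp : 0 < p)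
    {D : ℝ × ℝ → ℕ} (hD : {x | D x ≠ 0 ∧ 0 < truncPers ε x}.Finite) {t : T} {B : ℝ}
    (hB : ∀ x, D x ≠ 0 → |k x t| ≤ B) :
    |linearFunctional k ε p D t| ≤ B * totalPersPow ε p D := by
  have h1 : ∀ x, D x ≠ 0 → 0 < truncPers ε x → x ∈ hD.toFinset := fun x h h' => by simp [h, h']
  rw [linearFunctional_eq_sum k hp h1, totalPersPow_eq_sum hp h1, Finset.mul_sum]
  refine (Finset.abs_sum_le_sum_abs _ _).trans (Finset.sum_le_sum fun x hx => ?_)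
  have hw : 0 ≤ truncPers ε x ^ p := Real.rpow_nonneg (le_max_right _ _) _
  rw [abs_mul, abs_mul, Nat.abs_cast, abs_of_nonneg hw]
  have := mul_le_mul_of_nonneg_left (hB x ((hD.mem_toFinset.1 hx).1))
    (mul_nonneg (Nat.cast_nonneg (D x)) hw)
  linarith

/-- Adding a remainder `E` of total persistence at most `2 * totalPersPow ε p D` to `n` copies of
`D` changes the normalized functional by `O(1 / n)`. -/
theorem abs_normalizedFunctional_nsmul_add_sub_le {T : Type*} {k : ℝ × ℝ → T → ℝ} {ε p : ℝ}
    (hp : 0 < p) {D E : ℝ × ℝ → ℕ} (hD : {x | D x ≠ 0 ∧ 0 < truncPers ε x}.Finite)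
    (hE : {x | E x ≠ 0 ∧ 0 < truncPers ε x}.Finite)
    (hDE : totalPersPow ε p E ≤ 2 * totalPersPow ε p D) (n : ℕ) {t : T} {B : ℝ} (hB0 : 0 ≤ B)
    (hBD : ∀ x, D x ≠ 0 → |k x t| ≤ B) (hBE : ∀ x, E x ≠ 0 → |k x t| ≤ B) :
    |normalizedFunctional k ε p (n • D + E) t - normalizedFunctional k ε p D t| ≤
      4 * B / (n + 2) := by
  have hN := abs_linearFunctional_le hp hD hBD
  have hN' := abs_linearFunctional_le hp hE hBE
  have hW' := totalPersPow_nonneg ε p E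
  have hW := totalPersPow_nonneg ε p D
  unfold normalizedFunctional
  rw [totalPersPow_nsmul_add hp hD hE, linearFunctional_nsmul_add k hp hD hE]
  generalize totalPersPow ε p D = W at *
  generalize totalPersPow ε p E = W' at *
  generalize linearFunctional k ε p D t = N at *
  generalize linearFunctional k ε p E t = N' at *
  have hn : (0 : ℝ) ≤ n := Nat.cast_nonneg n
  have hR : 0 ≤ 4 * B / (n + 2) := by positivity
  -- If `W = 0`, then `W' = 0` too, and both functionals have the default value `0`.
  rcases hW.eq_or_lt with h0 | hWp
  · obtain rfl : W' = 0 := by linarith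
    simp [← h0, hR]
  rw [if_pos hWp]
  split_ifs with hs
  · rw [div_sub_div _ _ hs.ne' hWp.ne', abs_div, abs_of_pos (mul_pos hs hWp),
      div_le_div_iff₀ (mul_pos hs hWp) (by positivity)]
    have e : (n * N + N') * W - (n * W + W') * N = N' * W - W' * N := by ring
    have h1 : |N' * W - W' * N| ≤ 2 * B * (W' * W) := by
      refine (abs_sub _ _).trans ?_
      rw [abs_mul, abs_mul, abs_of_pos hWp, abs_of_nonneg hW']
      have a1 := mul_le_mul_of_nonneg_right hN' hW
      have a2 := mul_le_mul_of_nonneg_left hN hW'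
      linarith
    rw [e]
    calc _ ≤ 2 * B * (W' * W) * (n + 2) := mul_le_mul_of_nonneg_right h1 (by positivity)
      _ = 2 * B * W * (n * W' + 2 * W') := by ring
      -- The bound `W' ≤ 2 * W` enters only in the term with factor `n`, which yields `(n + 2) * W'
      -- ≤ 2 * (n * W + W')`.
      _ ≤ 2 * B * W * (n * (2 * W) + 2 * W') := by gcongr
      _ = _ := by ring
  -- A vanishing denominator with `W > 0` forces `n = 0`; the first functional is then `0` and the
  -- second at most `B`, within `4 * B / 2`.
  · have hn0 : (n : ℝ) = 0 := by
      by_contra hne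
      exact hs (add_pos_of_pos_of_nonneg (mul_pos (lt_of_le_of_ne hn (Ne.symm hne)) hWp) hW')
    rw [zero_sub, abs_neg, abs_div, abs_of_pos hWp, hn0, div_le_iff₀ hWp]
    have := mul_nonneg hB0 hW
    linarith

/-! ### Decomposition into periods and the theorem -/

theorem sublevelRank_singleton {φ : ℝ → ℝ} (c : ℝ) {s t : ℝ} (hst : s < t) :
    sublevelRank φ (Set.Icc c c) (φ c) s t = 0 := by
  unfold sublevelRank
  split_ifs with ht
  · have : sublevelComponents φ (Set.Icc c c) s t = ∅ := by
      rw [sublevelComponents, Set.image_eq_empty, Set.eq_empty_iff_forall_notMem]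
      rintro x ⟨hx, hxs⟩
      obtain rfl : x = c := le_antisymm hx.2 hx.1
      linarith
    rw [this, Set.ncard_empty, Nat.cast_zero]
  · rfl

theorem sublevelRank_nat_periods {φ : ℝ → ℝ} (hφ : Continuous φ) (hper : Function.Periodic φ 1)
    (c : ℝ) (n : ℕ) {s t : ℝ} (hst : s < t) :
    sublevelRank φ (Set.Icc c (c + n)) (φ c) s t =
      n * sublevelRank φ (Set.Icc c (c + 1)) (φ c) s t := by
  induction n with
  | zero => simpa using sublevelRank_singleton c hst
  | succ n ih =>
    have hn : Function.Periodic φ (n : ℝ) := by simpa using hper.nat_mul n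
    have h := sublevelRank_Icc_add hφ (a := c) (c := c + n) (b := c + n + 1) (by simp) (by simp)
      hst
    rw [hn c] at h
    have h' := congrFun (congrFun (sublevelRank_Icc_add_period hn c (c + 1) (φ c)) s) t
    rw [show c + 1 + (n : ℝ) = c + n + 1 by ring] at h'
    push_cast
    rw [← add_assoc, h, ih, h']
    ring

/-- The diagram of `φ` on `[0, R]` consists of whole periods and a remainder that is bounded by
two periods. -/
theorem exists_intervalDiagram_eq_nsmul_add (𝕂 : Type*) [Field 𝕂] {φ : ℝ → ℝ}
    (hφ : Continuous φ) (hper : Function.Periodic φ 1) {c m : ℝ} (hmax : ∀ x, φ x ≤ φ c)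
    (hm : ∀ x, m ≤ φ x) {R : ℝ} (hR : 1 < R) {ε p : ℝ} (hε : 0 < ε) (hp : 1 < p) :
    ∃ (n : ℕ) (r e : ℝ → ℝ → ℤ), R < n + 2 ∧ IsRankFunction r m (φ c) ∧
      IsRankFunction e m (φ c) ∧
      intervalDiagram 𝕂 φ c (c + 1) = rankDiagram r ∧
      intervalDiagram 𝕂 φ 0 R = n • rankDiagram r + rankDiagram e ∧
      totalPersPow ε p (rankDiagram e) ≤ 2 * totalPersPow ε p (rankDiagram r) := by
  -- The translate of `c` in `[0, 1)`; it lies in `[0, R]`, so `φ` attains its global maximum there.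
  set c₀ := Int.fract c with hc₀
  have hc₀0 : 0 ≤ c₀ := Int.fract_nonneg c
  have hc₀1 : c₀ < 1 := Int.fract_lt_one c
  have hz : Function.Periodic φ (⌊c⌋ : ℝ) := by simpa using hper.int_mul ⌊c⌋
  have hcc : c₀ + ⌊c⌋ = c := Int.fract_add_floor c
  have hφc : φ c₀ = φ c := by rw [← hz c₀, hcc]
  set n := ⌊R - c₀⌋₊ with hn
  have hn1 : (n : ℝ) ≤ R - c₀ := Nat.floor_le (by linarith)
  have hn2 : R - c₀ < n + 1 := Nat.lt_floor_add_one _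
  have hnper : Function.Periodic φ (n : ℝ) := by simpa using hper.nat_mul n
  set r := sublevelRank φ (Set.Icc c₀ (c₀ + 1)) (φ c) with hr
  have hrc : sublevelRank φ (Set.Icc c (c + 1)) (φ c) = r := by
    have := sublevelRank_Icc_add_period hz c₀ (c₀ + 1) (φ c)
    rwa [add_right_comm, hcc] at this
  set e₁ := sublevelRank φ (Set.Icc 0 c₀) (φ c) with he₁
  set e₂ := sublevelRank φ (Set.Icc (c₀ + n) R) (φ c) with he₂
  have hIr : IsRankFunction r m (φ c) := isRankFunction_sublevelRank hφ _ _ _ _ fun x _ => hm x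
  have hI₁ : IsRankFunction e₁ m (φ c) := isRankFunction_sublevelRank hφ _ _ _ _ fun x _ => hm x
  have hI₂ : IsRankFunction e₂ m (φ c) := isRankFunction_sublevelRank hφ _ _ _ _ fun x _ => hm x
  refine ⟨n, r, e₁ + e₂, by linarith, hIr, hI₁.add hI₂, ?_, ?_, ?_⟩
  · rw [intervalDiagram_eq_of_max 𝕂 (c := c) ⟨le_rfl, by linarith⟩ hmax, hrc]
  · rw [intervalDiagram_eq_of_max 𝕂 (c := c₀) ⟨hc₀0, by linarith⟩ (by rwa [hφc]), hφc,
      ← hIr.rankDiagram_nsmul, ← (hIr.nsmul n).rankDiagram_add (hI₁.add hI₂)]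
    refine rankDiagram_congr fun s t hst => ?_
    have h1 := sublevelRank_Icc_add hφ hc₀0 (show c₀ ≤ R by linarith) hst
    have h2 := sublevelRank_Icc_add hφ (a := c₀) (c := c₀ + n) (b := R) (by simp) (by linarith) hst
    have h3 := sublevelRank_nat_periods hφ hper c₀ n hst
    rw [hφc] at h1 h3
    rw [hnper, hφc] at h2
    rw [h1, h2, h3]
    simp only [Pi.add_apply, Pi.smul_apply, ← he₁, ← he₂, ← hr]
    rw [nsmul_eq_mul]
    ring
  -- Twice the persistence of `r` is that of `1 • r + r`, which allows comparison at the level of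
  -- ranks: `[0, c₀]` lies in the period `[c₀ - 1, c₀]`, and `[c₀ + n, R]` in the one starting at
  -- `c₀ + n`.
  · have h2 := totalPersPow_nsmul_add (p := p) (by linarith) (hIr.finite_truncPers hε)
      (hIr.finite_truncPers hε) 1
    rw [← hIr.rankDiagram_nsmul, ← (hIr.nsmul 1).rankDiagram_add hIr] at h2
    have h3 : 2 * totalPersPow ε p (rankDiagram r) =
        totalPersPow ε p (rankDiagram (1 • r + r)) := by
      rw [h2]; push_cast; ring
    rw [h3]
    refine (hI₁.add hI₂).totalPersPow_mono ((hIr.nsmul 1).add hIr) (fun s t hst => ?_) hε hp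
    have b1 := sublevelRank_mono hφ (a := 0) (b := c₀) (a' := c₀ - 1) (b' := c₀) (by linarith)
      le_rfl (φ c) hst
    have b2 := sublevelRank_mono hφ (a := c₀ + n) (b := R) (a' := c₀ + n) (b' := c₀ + 1 + n)
      le_rfl (by linarith) (φ c) hst
    rw [sublevelRank_Icc_add_period hnper] at b2
    have b3 := sublevelRank_Icc_add_period hper (c₀ - 1) c₀ (φ c)
    rw [sub_add_cancel] at b3
    rw [← b3] at b1
    simp only [Pi.add_apply, one_smul]
    exact add_le_add b1 b2

theorem mainTheorem1 {𝕂 : Type*} [Field 𝕂] {T : Type*}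
    (φ : ℝ → ℝ) (hφ : Continuous φ) (hper : Function.Periodic φ 1)
    (k : ℝ × ℝ → T → ℝ) (L C : ℝ)
    (hL : ∀ (x x' : ℝ × ℝ) (t : T), |k x t - k x' t| ≤ L * ‖x - x'‖)
    (hC : ∀ (r : ℝ) (t : T), |k (r, r) t| ≤ C)
    (ε p : ℝ) (hε : 0 < ε) (hp : 1 < p) :
    -- the sums that define the functionals are finite
    (∀ a b : ℝ, a ≤ b →
      {x : ℝ × ℝ | intervalDiagram 𝕂 φ a b x ≠ 0 ∧ 0 < truncPers ε x}.Finite) ∧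
    (∃ c ∈ Set.Icc (0 : ℝ) 1, ∀ x, φ x ≤ φ c) ∧
    ∀ c : ℝ, (∀ x, φ x ≤ φ c) →
      TendstoUniformly
        (fun R : ℝ => normalizedFunctional k ε p (intervalDiagram 𝕂 φ 0 R))
        (normalizedFunctional k ε p (intervalDiagram 𝕂 φ c (c + 1)))
        Filter.atTop ∧
      ∀ R : ℝ, 1 < R → ∀ t : T,
        |normalizedFunctional k ε p (intervalDiagram 𝕂 φ 0 R) t -
          normalizedFunctional k ε p (intervalDiagram 𝕂 φ c (c + 1)) t| ≤
            4 * (C + L * ((⨆ x, φ x) - ⨅ x, φ x)) / (R - 1) := by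
  have himage : φ '' Set.Icc 0 1 = Set.range φ := by
    simpa using hper.image_Icc one_pos 0
  have hbdd : BddBelow (Set.range φ) := by
    rw [← himage]
    exact (isCompact_Icc.image hφ).bddBelow
  have hm : ∀ x, ⨅ x, φ x ≤ φ x := fun x => ciInf_le hbdd x
  refine ⟨fun a b _ => ?_, ?_, fun c hc => ?_⟩
  · rw [intervalDiagram_eq_rankDiagram]
    exact (isRankFunction_sublevelRank hφ a b _ _ fun x _ => hm x).finite_truncPers hε
  · obtain ⟨c, hc, hmax⟩ := isCompact_Icc.exists_isMaxOn
      (Set.nonempty_Icc.2 (zero_le_one (α := ℝ))) hφ.continuousOn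
    refine ⟨c, hc, fun x => ?_⟩
    obtain ⟨y, hy, hyx⟩ : φ x ∈ φ '' Set.Icc 0 1 := himage ▸ Set.mem_range_self x
    rw [← hyx]
    exact hmax hy
  have hsup : ⨆ x, φ x = φ c :=
    le_antisymm (ciSup_le hc) (le_ciSup (f := φ) ⟨φ c, by rintro _ ⟨x, rfl⟩; exact hc x⟩ c)
  have hbound : ∀ R : ℝ, 1 < R → ∀ t : T,
      |normalizedFunctional k ε p (intervalDiagram 𝕂 φ 0 R) t -
        normalizedFunctional k ε p (intervalDiagram 𝕂 φ c (c + 1)) t| ≤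
          4 * (C + L * ((⨆ x, φ x) - ⨅ x, φ x)) / (R - 1) := by
    intro R hR t
    obtain ⟨n, r, e, hn, hr, he, hDr, hDR, hW⟩ :=
      exists_intervalDiagram_eq_nsmul_add 𝕂 hφ hper hc hm hR hε hp
    have hC0 : 0 ≤ C := (abs_nonneg _).trans (hC 0 t)
    have hL0 : 0 ≤ L := by
      simpa using (abs_nonneg _).trans (hL (1, 1) 0 t)
    -- Births and deaths lie between `min φ` and `max φ`, so a diagram point is within `max φ - min
    -- φ` of the diagonal point `(x.1, x.1)`, where the kernel is at most `C`.
    have hB : ∀ r' : ℝ → ℝ → ℤ, IsRankFunction r' (⨅ x, φ x) (φ c) →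
        ∀ x, rankDiagram r' x ≠ 0 → |k x t| ≤ C + L * (φ c - ⨅ x, φ x) := by
      intro r' hr' x hx
      obtain ⟨h12, h1, h2⟩ := hr'.le_of_rankDiagram_ne_zero hx
      have hx' : ‖x - (x.1, x.1)‖ ≤ φ c - ⨅ x, φ x := by
        rw [Prod.norm_def]
        refine max_le ?_ ?_
        · simp only [Prod.fst_sub, sub_self, norm_zero]
          linarith
        · rw [Prod.snd_sub, Real.norm_of_nonneg (by simp only; linarith)]
          simp only
          linarith
      calc |k x t| ≤ |k x t - k (x.1, x.1) t| + |k (x.1, x.1) t| := by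
            simpa using abs_add_le (k x t - k (x.1, x.1) t) (k (x.1, x.1) t)
        _ ≤ L * (φ c - ⨅ x, φ x) + C :=
            add_le_add ((hL _ _ _).trans (mul_le_mul_of_nonneg_left hx' hL0)) (hC _ _)
        _ = _ := add_comm _ _
    have hB0 : 0 ≤ C + L * (φ c - ⨅ x, φ x) :=
      add_nonneg hC0 (mul_nonneg hL0 (sub_nonneg.2 (hm c)))
    rw [hDr, hDR, hsup]
    refine (abs_normalizedFunctional_nsmul_add_sub_le (by linarith) (hr.finite_truncPers hε)
      (he.finite_truncPers hε) hW n hB0 (hB r hr) (hB e he)).trans ?_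
    exact div_le_div_of_nonneg_left (by linarith) (by linarith) (by linarith)
  refine ⟨?_, hbound⟩
  rw [Metric.tendstoUniformly_iff]
  intro η hη
  have hlim : Filter.Tendsto
      (fun R : ℝ => 4 * (C + L * ((⨆ x, φ x) - ⨅ x, φ x)) / (R - 1)) Filter.atTop (nhds 0) :=
    tendsto_const_nhds.div_atTop (Filter.tendsto_atTop_add_const_right _ (-1) Filter.tendsto_id)
  filter_upwards [hlim.eventually_lt_const hη, Filter.eventually_gt_atTop 1] with R h1 h2 t
  rw [dist_comm, Real.dist_eq]
  exact (hbound R h2 t).trans_lt h1
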